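/- Let \((M,g,\nabla)\) be a Hessian manifold: \(M\) is a smooth (Hausdorff) manifold of finite dimension \(n\) without boundary, \(\nabla\) is a smooth torsion-free flat affine connection on \(M\), and \(g\) is a smooth Riemannian metric which near every point has the form \(g=\nabla d\varphi\) for some smooth local function \(\varphi\). Let \(\nu:T^*M\to M\) be the cotangent bundle, \(\theta_\alpha(w)=\alpha(d\nu\,w)\) the tautological one-form and \(\Omega=-d\theta\) the canonical symplectic form. Let \(V=\ker d\nu\) be the vertical distribution, and let \(H_\alpha\subset T_\alpha(T^*M)\) be the set of initial velocities of the curves obtained by parallel transport of the covector \(\alpha\), with respect to the dual connection of \(\nabla\), along smooth curves in \(M\). Then: 1. Each \(H_\alpha\) is a linear subspace, and \(T(T^*M)=H\oplus V\). Let \(K:T(T^*M)\to T(T^*M)\) be the unique fibrewise linear map with \(K|_H=\mathrm{id}\) and \(K|_V=-\mathrm{id}\). 2. There is a unique neutral metric \(G\) on \(T^*M\) (a smooth nondegenerate symmetric bilinear form of signature \((n,n)\)) such that \(\Omega(u,v)=G(Ku,v)\) for all tangent vectors \(u,v\) of \(T^*M\) at a common point. 3. \((G,K,\Omega)\) is a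 para-Kähler structure on \(T^*M\): \(K\) is smooth, \(K^2=\mathrm{id}\), its \(\pm1\) eigenbundles have equal rank, its Nijenhuis tensor vanishes, \(G(Ku,Kv)=-G(u,v)\), and \(\Omega\) is smooth, closed and nondegenerate, with \(\Omega(u,v)=G(Ku,v)\). 4. The eigenbundles \(E_\pm=\ker(K\mp\mathrm{id})\) are \(E_+=H\) and \(E_-=V\). They are maximally isotropic for \(G\), Lagrangian for \(\Omega\), and integrable (closed under the Lie bracket of vector fields), and \(T(T^*M)=E_+\oplus E_-\). -/

import Mathlib

open Bundle Set VectorField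
open scoped Manifold ContDiff Topology

noncomputable section

/-! ### Differential forms, distributions and endomorphism fields on a manifold -/

section General

variable {V : Type*} [NormedAddCommGroup V] [NormedSpace ℝ V]
  {HN : Type*} [TopologicalSpace HN] (J : ModelWithCorners ℝ V HN)
  {N : Type*} [TopologicalSpace N] [ChartedSpace HN N]

/-- A vector field on `N` that is smooth, as a section of the tangent bundle. -/
def IsSmoothField [IsManifold J 1 N] (X : ∀ p : N, TangentSpace J p) : Prop :=
  ContMDiff J J.tangent ∞ (fun p => (⟨p, X p⟩ : TangentBundle J N))

/-- A differential `n`-form `η` on `N` read in the preferred chart around `p`: the pull-back of `ω`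
by the inverse of that chart, a form on the model vector space. -/
def formInChart {n : ℕ} (η : ∀ p : N, TangentSpace J p [⋀^Fin n]→L[ℝ] ℝ) (p : N) (y : V) :
    V [⋀^Fin n]→L[ℝ] ℝ :=
  (η ((extChartAt J p).symm y)).compContinuousLinearMap
    (mfderivWithin 𝓘(ℝ, V) J (extChartAt J p).symm (range J) y)

/-- The exterior derivative of a differential form on a manifold: at `p`, read the form in the
chart around `p`, take the exterior derivative in the model vector space, and pull back. -/
def mExtDeriv {n : ℕ} (η : ∀ p : N, TangentSpace J p [⋀^Fin n]→L[ℝ] ℝ) (p : N) :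
    TangentSpace J p [⋀^Fin (n + 1)]→L[ℝ] ℝ :=
  (extDerivWithin (formInChart J η p) (range J) (extChartAt J p p)).compContinuousLinearMap
    (mfderiv J 𝓘(ℝ, V) (extChartAt J p) p)

/-- A 2-form is symplectic if it is smooth, closed and nondegenerate. -/
structure IsSymplecticForm [IsManifold J 1 N]
    (Ω : ∀ p : N, TangentSpace J p [⋀^Fin 2]→L[ℝ] ℝ) : Prop where
  smooth : ∀ X Y : ∀ p : N, TangentSpace J p, IsSmoothField J X → IsSmoothField J Y →
    ContMDiff J 𝓘(ℝ, ℝ) ∞ (fun p => Ω p ![X p, Y p])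
  closed : ∀ p, mExtDeriv J Ω p = 0
  nondegenerate : ∀ p (u : TangentSpace J p), (∀ v, Ω p ![u, v] = 0) → u = 0

/-- A distribution is involutive (integrable) if it is closed under the Lie bracket of smooth
vector fields. -/
def IsInvolutive [IsManifold J 1 N] (D : ∀ p : N, Submodule ℝ (TangentSpace J p)) : Prop :=
  ∀ X Y : ∀ p : N, TangentSpace J p, IsSmoothField J X → IsSmoothField J Y →
    (∀ p, X p ∈ D p) → (∀ p, Y p ∈ D p) → ∀ p, mlieBracket J X Y p ∈ D p

/-- The `+1` eigenbundle `ker (K - id)` of a field `K` of endomorphisms. -/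
def eigenPlus (K : ∀ p : N, TangentSpace J p →L[ℝ] TangentSpace J p) (p : N) :
    Submodule ℝ (TangentSpace J p) :=
  (K p - ContinuousLinearMap.id ℝ (TangentSpace J p)).ker

/-- The `-1` eigenbundle `ker (K + id)` of a field `K` of endomorphisms. -/
def eigenMinus (K : ∀ p : N, TangentSpace J p →L[ℝ] TangentSpace J p) (p : N) :
    Submodule ℝ (TangentSpace J p) :=
  (K p + ContinuousLinearMap.id ℝ (TangentSpace J p)).ker

/-- A para-complex structure: a smooth field `K` of endomorphisms of the tangent spaces with
`K² = id`, with `±1` eigenbundles of equal rank, and integrable, i.e. with vanishing Nijenhuis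
tensor. -/
structure IsParaComplex [IsManifold J 1 N]
    (K : ∀ p : N, TangentSpace J p →L[ℝ] TangentSpace J p) : Prop where
  smooth : ContMDiff J (J.prod 𝓘(ℝ, V →L[ℝ] V)) ∞
    (fun p => TotalSpace.mk' (V →L[ℝ] V)
      (E := fun p : N => TangentSpace J p →L[ℝ] TangentSpace J p) p (K p))
  sq_eq_id : ∀ p (u : TangentSpace J p), K p (K p u) = u
  equal_rank : ∀ p, Module.finrank ℝ (eigenPlus J K p) = Module.finrank ℝ (eigenMinus J K p)
  nijenhuis : ∀ X Y : ∀ p : N, TangentSpace J p, IsSmoothField J X → IsSmoothField J Y → ∀ p,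
    mlieBracket J X Y p
      + mlieBracket J (fun q => K q (X q)) (fun q => K q (Y q)) p
      - K p (mlieBracket J (fun q => K q (X q)) Y p)
      - K p (mlieBracket J X (fun q => K q (Y q)) p) = 0

/-- The quadratic form `u ↦ B u u` of a bilinear form. -/
def quadOf {p : N} (B : TangentSpace J p →L[ℝ] TangentSpace J p →L[ℝ] ℝ) :
    QuadraticForm ℝ (TangentSpace J p) :=
  LinearMap.BilinMap.toQuadraticMap
    (LinearMap.mk₂ ℝ (fun u v => B u v) (by simp) (by simp) (by simp) (by simp))

/-- A neutral metric: a smooth field of nondegenerate symmetric bilinear forms on the tangent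
spaces whose positive and negative indices of inertia agree. -/
structure IsNeutralMetric [IsManifold J 1 N]
    (G : ∀ p : N, TangentSpace J p →L[ℝ] TangentSpace J p →L[ℝ] ℝ) : Prop where
  smooth : ContMDiff J (J.prod 𝓘(ℝ, V →L[ℝ] V →L[ℝ] ℝ)) ∞
    (fun p => TotalSpace.mk' (V →L[ℝ] V →L[ℝ] ℝ)
      (E := fun p : N => TangentSpace J p →L[ℝ] TangentSpace J p →L[ℝ] ℝ) p (G p))
  symm : ∀ p (u v : TangentSpace J p), G p u v = G p v u
  nondegenerate : ∀ p (u : TangentSpace J p), (∀ v, G p u v = 0) → u = 0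
  neutral : ∀ p, sigPos (quadOf J (G p)) = sigNeg (quadOf J (G p))

/-- A para-Kähler structure `(G, K, Ω)`: a neutral metric `G`, a para-complex structure `K` that
is an anti-isometry of `G`, and a symplectic form `Ω` with `Ω(u, v) = G(Ku, v)`. -/
structure IsParaKahler [IsManifold J 1 N]
    (G : ∀ p : N, TangentSpace J p →L[ℝ] TangentSpace J p →L[ℝ] ℝ)
    (K : ∀ p : N, TangentSpace J p →L[ℝ] TangentSpace J p)
    (Ω : ∀ p : N, TangentSpace J p [⋀^Fin 2]→L[ℝ] ℝ) : Prop where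
  neutralMetric : IsNeutralMetric J G
  paraComplex : IsParaComplex J K
  symplectic : IsSymplecticForm J Ω
  antiIsometry : ∀ p (u v : TangentSpace J p), G p (K p u) (K p v) = -G p u v
  compatible : ∀ p (u v : TangentSpace J p), Ω p ![u, v] = G p (K p u) v

end General

section LinearAlgebra

variable {W : Type*} [AddCommGroup W] [Module ℝ W] [TopologicalSpace W]

/-- `L` is Lagrangian for the 2-form `Ω`: it is its own `Ω`-orthogonal complement. -/
def IsLagrangianSubspace (Ω : W [⋀^Fin 2]→L[ℝ] ℝ) (L : Submodule ℝ W) : Prop :=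
  ∀ u : W, u ∈ L ↔ ∀ v ∈ L, Ω ![u, v] = 0

/-- `L` is totally isotropic for the bilinear form `B`. -/
def IsIsotropicSubspace (B : W →L[ℝ] W →L[ℝ] ℝ) (L : Submodule ℝ W) : Prop :=
  ∀ u ∈ L, ∀ v ∈ L, B u v = 0

/-- `L` is maximal among the totally isotropic subspaces for `B`. -/
def IsMaximalIsotropic (B : W →L[ℝ] W →L[ℝ] ℝ) (L : Submodule ℝ W) : Prop :=
  Maximal (IsIsotropicSubspace B) L

end LinearAlgebra

/-! ### Hessian manifolds -/

section Hessian

variable {E : Type*} [NormedAddCommGroup E] [NormedSpace ℝ E] [FiniteDimensional ℝ E]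
  {M : Type*} [TopologicalSpace M] [ChartedSpace E M] [IsManifold 𝓘(ℝ, E) ∞ M]

/-- An affine connection is flat: its curvature
`R(X, Y)Z = ∇_X ∇_Y Z - ∇_Y ∇_X Z - ∇_[X, Y] Z` vanishes. (`cov Z x (X x)` is `(∇_X Z)(x)`.) -/
def IsFlatConnection
    (cov : CovariantDerivative 𝓘(ℝ, E) E (TangentSpace 𝓘(ℝ, E) : M → Type _)) : Prop :=
  ∀ X Y Z : ∀ x : M, TangentSpace 𝓘(ℝ, E) x,
    IsSmoothField 𝓘(ℝ, E) X → IsSmoothField 𝓘(ℝ, E) Y → IsSmoothField 𝓘(ℝ, E) Z → ∀ x,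
      cov (fun y => cov Z y (Y y)) x (X x) - cov (fun y => cov Z y (X y)) x (Y x)
        - cov Z x (mlieBracket 𝓘(ℝ, E) X Y x) = 0

/-- `(M, g, ∇)` is a Hessian manifold: `∇` is a smooth torsion-free flat affine connection, and
the Riemannian metric `g` is locally a Hessian `∇dφ`, i.e. every point has an open neighbourhood
`U` with a smooth function `φ` on `U` such that `g(X, Y) = X(Yφ) - (∇_X Y)φ` on `U` for all smooth
vector fields `X`, `Y`. -/
structure IsHessianManifold
    (g : ContMDiffRiemannianMetric 𝓘(ℝ, E) ∞ E (TangentSpace 𝓘(ℝ, E) : M → Type _))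
    (cov : CovariantDerivative 𝓘(ℝ, E) E (TangentSpace 𝓘(ℝ, E) : M → Type _)) : Prop where
  smooth : CovariantDerivative.ContMDiffCovariantDerivative cov ∞
  torsionFree : cov.torsion = 0
  flat : IsFlatConnection cov
  hessian : ∀ x : M, ∃ U : Set M, IsOpen U ∧ x ∈ U ∧ ∃ φ : M → ℝ,
    ContMDiffOn 𝓘(ℝ, E) 𝓘(ℝ, ℝ) ∞ φ U ∧
    ∀ X Y : ∀ x : M, TangentSpace 𝓘(ℝ, E) x,
      IsSmoothField 𝓘(ℝ, E) X → IsSmoothField 𝓘(ℝ, E) Y → ∀ y ∈ U,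
        g.inner y (X y) (Y y) =
          mvfderiv 𝓘(ℝ, E) (fun z => mvfderiv 𝓘(ℝ, E) φ z (Y z)) y (X y)
            - mvfderiv 𝓘(ℝ, E) φ y (cov Y y (X y))

end Hessian

/-! ### The cotangent bundle -/

section Cotangent

variable (E : Type*) [NormedAddCommGroup E] [NormedSpace ℝ E]
  (M : Type*) [TopologicalSpace M] [ChartedSpace E M] [IsManifold 𝓘(ℝ, E) ∞ M]

/-- The cotangent bundle `T*M`; its points are pairs `⟨x, α⟩` with `α` a covector at `x`. -/
abbrev CotangentBundle : Type _ :=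
  TotalSpace (E →L[ℝ] ℝ) (fun x : M => TangentSpace 𝓘(ℝ, E) x →L[ℝ] ℝ)

/-- The model with corners of the cotangent bundle: charts take values in `E × E*`. -/
abbrev cotangentModel : ModelWithCorners ℝ (E × (E →L[ℝ] ℝ)) (ModelProd E (E →L[ℝ] ℝ)) :=
  𝓘(ℝ, E).prod 𝓘(ℝ, E →L[ℝ] ℝ)

variable {E M}

/-- The derivative `dν` at `α` of the bundle projection `ν : T*M → M`. -/
def dProj (α : CotangentBundle E M) :
    TangentSpace (cotangentModel E) α →L[ℝ] TangentSpace 𝓘(ℝ, E) α.proj :=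
  mfderiv (cotangentModel E) 𝓘(ℝ, E) (fun β : CotangentBundle E M => β.proj) α

variable (E M) in
/-- The tautological one-form `θ_α(w) = α(dν w)` on `T*M`. -/
def tautologicalForm (α : CotangentBundle E M) :
    TangentSpace (cotangentModel E) α [⋀^Fin 1]→L[ℝ] ℝ :=
  ContinuousAlternatingMap.ofSubsingleton ℝ (TangentSpace (cotangentModel E) α) ℝ (0 : Fin 1)
    (α.snd.comp (dProj α))

variable (E M) in
/-- The canonical symplectic form `Ω = -dθ` on `T*M`. -/
def canonicalForm (α : CotangentBundle E M) :
    TangentSpace (cotangentModel E) α [⋀^Fin 2]→L[ℝ] ℝ :=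
  -mExtDeriv (cotangentModel E) (tautologicalForm E M) α

/-- The vertical subspace `V_α = ker dν_α`. -/
def verticalSpace (α : CotangentBundle E M) :
    Submodule ℝ (TangentSpace (cotangentModel E) α) :=
  (dProj α).ker

/-- A smooth curve `c` of covectors, defined on the open interval `(-ε, ε)`, is parallel for the
dual connection `∇*` induced by `∇`: for all smooth vector fields `Y`, along the projected curve
`γ = ν ∘ c`, one has `d/dt (c(t)(Y)) = c(t)(∇_{γ'(t)} Y)`, i.e. `(∇*_{γ'} c)(Y) = 0`. -/
structure IsParallelCovectorCurve
    (cov : CovariantDerivative 𝓘(ℝ, E) E (TangentSpace 𝓘(ℝ, E) : M → Type _))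
    (c : ℝ → CotangentBundle E M) (ε : ℝ) : Prop where
  smooth : ContMDiffOn 𝓘(ℝ, ℝ) (cotangentModel E) ∞ c (Ioo (-ε) ε)
  parallel : ∀ t ∈ Ioo (-ε) ε, ∀ Y : ∀ x : M, TangentSpace 𝓘(ℝ, E) x,
    IsSmoothField 𝓘(ℝ, E) Y →
      HasDerivAt (fun s => (c s).snd (Y (c s).proj))
        ((c t).snd (cov Y (c t).proj
          (mfderiv 𝓘(ℝ, ℝ) 𝓘(ℝ, E) (fun s => (c s).proj) t (1 : ℝ)))) t

/-- The velocities at `α` of the curves through `α` obtained by parallel transport of `α` along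
smooth curves in `M`. -/
def horizontalVelocities
    (cov : CovariantDerivative 𝓘(ℝ, E) E (TangentSpace 𝓘(ℝ, E) : M → Type _))
    (α : CotangentBundle E M) : Set (TangentSpace (cotangentModel E) α) :=
  {w | ∃ ε > 0, ∃ c : ℝ → CotangentBundle E M, IsParallelCovectorCurve cov c ε ∧
    tangentMap 𝓘(ℝ, ℝ) (cotangentModel E) c ⟨0, (1 : ℝ)⟩ =
      (⟨α, w⟩ : TangentBundle (cotangentModel E) (CotangentBundle E M))}

/-- The `∇`-horizontal subspace `H_α`, spanned by the velocities of parallel curves. -/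
def horizontalSpace
    (cov : CovariantDerivative 𝓘(ℝ, E) E (TangentSpace 𝓘(ℝ, E) : M → Type _))
    (α : CotangentBundle E M) : Submodule ℝ (TangentSpace (cotangentModel E) α) :=
  Submodule.span ℝ (horizontalVelocities cov α)

/-- `K` is induced by the horizontal/vertical splitting: it is `+1` on `H` and `-1` on `V`. -/
def IsInducedBySplitting
    (cov : CovariantDerivative 𝓘(ℝ, E) E (TangentSpace 𝓘(ℝ, E) : M → Type _))
    (K : ∀ α : CotangentBundle E M,
      TangentSpace (cotangentModel E) α →L[ℝ] TangentSpace (cotangentModel E) α) : Prop :=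
  ∀ α, (∀ u ∈ horizontalSpace cov α, K α u = u) ∧ (∀ u ∈ verticalSpace α, K α u = -u)

end Cotangent

end

/-!
The statement is local on `M`, so everything is computed in a chart of `M` with coordinates `x`
and in the induced chart `(x, p)` of `T*M` with values in `E × E*`. The connection becomes
`∇_v Y = DY(v) + Γ_x(v, Y)` (`chartD_cov`), where `Γ` is smooth, symmetric because `∇` has no
torsion (`christoffel_symm`), and satisfies the usual differential equation because `∇` is flat
(`christoffel_flat`). In such a chart the following holds.

* `θ = p dx`, so `Ω((v, a), (w, b)) = b(v) - a(w)` has constant coefficients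
  (`canonicalForm_apply`). Hence `Ω` is symplectic.
* A curve `(x(t), p(t))` is parallel for the dual connection iff `p' = p ∘ Γ_x(x', ·)`. This
  is an ordinary differential equation, which can be solved with `x' = v` constant, so `H` is the
  graph `{(v, p ∘ Γ_x(v, ·))}` (`mem_horizontalVelocities_iff`), while `V = {(0, a)}`. In particular
  `H` is a linear complement of `V`, and the involution is
  `K(v, a) = (v, 2 p ∘ Γ_x(v, ·) - a)` (`modelParacomplex`, `chartD_splittingInvolution`).
* Symmetry of `Γ` gives `Ω(Ku, Kv) = -Ω(u, v)` (`modelSymplectic_modelParacomplex`). This single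
  identity makes `G(u, v) = Ω(Ku, v)` symmetric, makes `K` an anti-isometry of `G` (so that `G` is
  neutral), and makes both eigenspaces of `K` Lagrangian, hence of equal dimension and maximal
  isotropic for `G`.
* The differential of `z ↦ K_z` is explicit, and the Nijenhuis tensor of `K` reduces to the
  curvature of `Γ` paired with `p`, which vanishes (`nijenhuis_modelParacomplex_eq_zero`). On
  sections of an eigenbundle of `K` the Nijenhuis tensor is `2([X, Y] ∓ K[X, Y])`, so the
  eigenbundles are involutive.

To stay within one manifold-independent formalism, `chartD p q` denotes the differential at `q` of
the preferred chart around `p`, for any manifold; it is used both for `M` and for `T*M`.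
-/

/-! ### Reading a manifold in a chart -/

section ChartReading

variable {V : Type*} [NormedAddCommGroup V] [NormedSpace ℝ V]
  {HN : Type*} [TopologicalSpace HN] (J : ModelWithCorners ℝ V HN)
  {N : Type*} [TopologicalSpace N] [ChartedSpace HN N] [IsManifold J ∞ N]

/-- The differential at `q` of the preferred chart around `p`. -/
noncomputable def chartD (p q : N) : TangentSpace J q →L[ℝ] V :=
  (trivializationAt V (TangentSpace J) p).continuousLinearMapAt ℝ q

/-- The inverse of the differential at `q` of the preferred chart around `p`; it is `0` if `q` is
outside the domain of the chart. -/
noncomputable def chartDSymm (p q : N) : V →L[ℝ] TangentSpace J q :=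
  (trivializationAt V (TangentSpace J) p).symmL ℝ q

variable {J}

theorem chartD_chartDSymm {p q : N} (hq : q ∈ (chartAt HN p).source) (v : V) :
    chartD J p q (chartDSymm J p q v) = v :=
  (trivializationAt V (TangentSpace J) p).continuousLinearMapAt_symmL hq v

theorem chartDSymm_chartD {p q : N} (hq : q ∈ (chartAt HN p).source) (v : TangentSpace J q) :
    chartDSymm J p q (chartD J p q v) = v :=
  (trivializationAt V (TangentSpace J) p).symmL_continuousLinearMapAt hq v

theorem chartD_injective {p q : N} (hq : q ∈ (chartAt HN p).source) :
    Function.Injective (chartD J p q) :=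
  Function.LeftInverse.injective (chartDSymm_chartD hq)

theorem chartD_eq_mfderiv {p q : N} (hq : q ∈ (chartAt HN p).source) :
    chartD J p q = mfderiv J 𝓘(ℝ, V) (extChartAt J p) q :=
  TangentBundle.continuousLinearMapAt_trivializationAt hq

theorem chartDSymm_eq_mfderivWithin {p q : N} (hq : q ∈ (chartAt HN p).source) :
    chartDSymm J p q
      = mfderivWithin 𝓘(ℝ, V) J (extChartAt J p).symm (range J) (extChartAt J p q) :=
  TangentBundle.symmL_trivializationAt hq

theorem chartD_self (p : N) : chartD J p p = ContinuousLinearMap.id ℝ V := by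
  rw [chartD_eq_mfderiv (mem_chart_source HN p)]
  exact mfderiv_extChartAt_self

theorem trivializationAt_tangent_apply {p q : N} (hq : q ∈ (chartAt HN p).source)
    (u : TangentSpace J q) :
    trivializationAt V (TangentSpace J) p (⟨q, u⟩ : TangentBundle J N) = (q, chartD J p q u) := by
  rw [chartD, Trivialization.continuousLinearMapAt_apply,
    Trivialization.coe_linearMapAt_of_mem _ hq]
  rfl

/-- Tangent vectors at possibly different points are compared through their chart representatives,
which avoids transport along an equality of base points. -/
theorem tangentBundle_eq_iff {p : N} {z z' : TangentBundle J N}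
    (hz : z.proj ∈ (chartAt HN p).source) (hz' : z'.proj ∈ (chartAt HN p).source) :
    z = z' ↔ z.proj = z'.proj ∧ chartD J p z.proj z.snd = chartD J p z'.proj z'.snd := by
  constructor
  · rintro rfl
    exact ⟨rfl, rfl⟩
  · rintro ⟨h1, h2⟩
    apply (trivializationAt V (TangentSpace J) p).injOn
    · exact (Trivialization.mem_source _).2 hz
    · exact (Trivialization.mem_source _).2 hz'
    · have e1 := trivializationAt_tangent_apply hz z.snd
      have e2 := trivializationAt_tangent_apply hz' z'.snd
      exact e1.trans ((Prod.ext h1 h2).trans e2.symm)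

/-- The vector field `X` read in the preferred chart around `p`. -/
noncomputable def fieldInChart (X : ∀ q : N, TangentSpace J q) (p : N) (y : V) : V :=
  chartD J p ((extChartAt J p).symm y) (X ((extChartAt J p).symm y))

theorem fieldInChart_extChartAt (X : ∀ q : N, TangentSpace J q) {p q : N}
    (hq : q ∈ (chartAt HN p).source) :
    fieldInChart X p (extChartAt J p q) = chartD J p q (X q) := by
  have : q ∈ (extChartAt J p).source := by rwa [extChartAt_source]
  rw [fieldInChart, (extChartAt J p).left_inv this]

theorem contMDiffAt_field_iff {n : ℕ∞ω} (hn : n ≤ ∞) {X : ∀ q : N, TangentSpace J q} {p q : N}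
    (hq : q ∈ (chartAt HN p).source) :
    ContMDiffAt J J.tangent n (fun q => (⟨q, X q⟩ : TangentBundle J N)) q ↔
      ContMDiffAt J 𝓘(ℝ, V) n (fun q => chartD J p q (X q)) q := by
  have : ContMDiffVectorBundle n V (TangentSpace J : N → Type _) J := .of_le hn
  have hm : (⟨q, X q⟩ : TangentBundle J N) ∈ (trivializationAt V (TangentSpace J) p).source :=
    (Trivialization.mem_source _).2 hq
  refine ((trivializationAt V (TangentSpace J) p).contMDiffAt_iff
    (f := fun q => (⟨q, X q⟩ : TangentBundle J N)) hm).trans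
    ((and_iff_right contMDiffAt_id).trans ?_)
  refine Filter.EventuallyEq.contMDiffAt_iff ?_
  filter_upwards [(chartAt HN p).open_source.mem_nhds hq] with r hr
  rw [trivializationAt_tangent_apply hr]

variable [J.Boundaryless]

omit [IsManifold J ∞ N] [J.Boundaryless] in
theorem symm_mem_source {p : N} {y : V} (hy : y ∈ (extChartAt J p).target) :
    (extChartAt J p).symm y ∈ (chartAt HN p).source := by
  rw [← extChartAt_source J]
  exact (extChartAt J p).map_target hy

theorem contMDiffAt_extChartAt_symm {p : N} {y : V} (hy : y ∈ (extChartAt J p).target) :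
    ContMDiffAt 𝓘(ℝ, V) J ∞ (extChartAt J p).symm y :=
  (contMDiffOn_extChartAt_symm p).contMDiffAt ((isOpen_extChartAt_target p).mem_nhds hy)

theorem contDiffAt_comp_symm {W : Type*} [NormedAddCommGroup W] [NormedSpace ℝ W] {n : ℕ∞ω}
    (hn : n ≤ ∞) {f : N → W} {p : N} {y : V} (hy : y ∈ (extChartAt J p).target)
    (hf : ContMDiffAt J 𝓘(ℝ, W) n f ((extChartAt J p).symm y)) :
    ContDiffAt ℝ n (f ∘ (extChartAt J p).symm) y :=
  (hf.comp y ((contMDiffAt_extChartAt_symm hy).of_le hn)).contDiffAt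

/-- The differential of a change of charts. -/
theorem fderiv_extChartAt_comp_symm {p q : N} {y : V} (hy : y ∈ (extChartAt J p).target)
    (hyq : (extChartAt J p).symm y ∈ (chartAt HN q).source) (v : V) :
    fderiv ℝ (extChartAt J q ∘ (extChartAt J p).symm) y v
      = chartD J q ((extChartAt J p).symm y) (chartDSymm J p ((extChartAt J p).symm y) v) := by
  rw [chartD_eq_mfderiv hyq, chartDSymm_eq_mfderivWithin (symm_mem_source hy),
    (extChartAt J p).right_inv hy, J.range_eq_univ, mfderivWithin_univ, ← mfderiv_eq_fderiv]
  rw [mfderiv_comp y (mdifferentiableAt_extChartAt hyq)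
    ((contMDiffAt_extChartAt_symm hy).mdifferentiableAt (by simp))]
  rfl

/-- In the chart around `p`, the Lie bracket at `p` is the Lie bracket of vector fields on the
model space. -/
theorem mlieBracket_eq_lieBracket_fieldInChart (X Y : ∀ q : N, TangentSpace J q) (p : N) :
    mlieBracket J X Y p
      = lieBracket ℝ (fieldInChart X p) (fieldInChart Y p) (extChartAt J p p) := by
  have key : ∀ Z : ∀ q : N, TangentSpace J q,
      mpullbackWithin 𝓘(ℝ, V) J (extChartAt J p).symm Z (range J)
        =ᶠ[𝓝 (extChartAt J p p)] fieldInChart Z p := by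
    intro Z
    filter_upwards [(isOpen_extChartAt_target p).mem_nhds (mem_extChartAt_target p)] with y hy
    have hq := symm_mem_source hy
    rw [mpullbackWithin_apply, fieldInChart, chartD_eq_mfderiv hq]
    have h1 := mfderiv_extChartAt_comp_mfderivWithin_extChartAt_symm (I := J) hy
    have h2 := mfderivWithin_extChartAt_symm_comp_mfderiv_extChartAt (I := J) hy
    rw [ContinuousLinearMap.inverse_eq h2 h1]
    rfl
  have hinv : ∀ w : V, (mfderiv J 𝓘(ℝ, V) (extChartAt J p) p).inverse w = w := fun w =>
    (congrArg (fun L : V →L[ℝ] V => L.inverse w) (mfderiv_extChartAt_self (I := J) (x := p))).trans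
      (congrArg (fun L : V →L[ℝ] V => L w) ContinuousLinearMap.inverse_id)
  rw [← mlieBracketWithin_univ, mlieBracketWithin_apply]
  refine (hinv _).trans ?_
  rw [preimage_univ, univ_inter, J.range_eq_univ]
  have huniv : ∀ A B : V → V, lieBracketWithin ℝ A B univ = lieBracket ℝ A B :=
    fun A B => lieBracketWithin_univ
  refine (congrFun (huniv _ _) _).trans ?_
  have hX := key X
  have hY := key Y
  rw [J.range_eq_univ] at hX hY
  exact hX.lieBracket_vectorField_eq hY

theorem mfderiv_apply_eq_fderiv {p q : N} (hq : q ∈ (chartAt HN p).source)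
    {W : Type*} [NormedAddCommGroup W] [NormedSpace ℝ W] {f : N → W}
    (hf : MDifferentiableAt J 𝓘(ℝ, W) f q) (u : TangentSpace J q) :
    mfderiv J 𝓘(ℝ, W) f q u
      = fderiv ℝ (f ∘ (extChartAt J p).symm) (extChartAt J p q) (chartD J p q u) := by
  have hq' : q ∈ (extChartAt J p).source := by rwa [extChartAt_source]
  have hy := (extChartAt J p).map_source hq'
  have hl := (extChartAt J p).left_inv hq'
  have hf' : MDifferentiableAt J 𝓘(ℝ, W) f ((extChartAt J p).symm (extChartAt J p q)) := by
    rwa [hl]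
  rw [← mfderiv_eq_fderiv, mfderiv_comp _ hf'
    ((contMDiffAt_extChartAt_symm hy).mdifferentiableAt (by simp))]
  conv_lhs => rw [← chartDSymm_chartD hq u, chartDSymm_eq_mfderivWithin hq, J.range_eq_univ,
    mfderivWithin_univ]
  have hcongr : ∀ r, r = q → ∀ v : V,
      (mfderiv J 𝓘(ℝ, W) f q : V →L[ℝ] W) v = (mfderiv J 𝓘(ℝ, W) f r : V →L[ℝ] W) v := by
    rintro _ rfl _
    rfl
  exact hcongr _ hl _

omit [J.Boundaryless] in
theorem fieldInChart_add (X Y : ∀ q : N, TangentSpace J q) (p : N) :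
    fieldInChart (X + Y) p = fun y => fieldInChart X p y + fieldInChart Y p y := by
  ext y
  exact map_add _ _ _

omit [J.Boundaryless] in
theorem fieldInChart_smul (f : N → ℝ) (X : ∀ q : N, TangentSpace J q) (p : N) :
    fieldInChart (f • X) p
      = fun y => (f ∘ (extChartAt J p).symm) y • fieldInChart X p y := by
  ext y
  exact map_smul _ _ _

theorem differentiableAt_comp_symm {W : Type*} [NormedAddCommGroup W] [NormedSpace ℝ W]
    {f : N → W} {p q : N} (hq : q ∈ (chartAt HN p).source)
    (hf : MDifferentiableAt J 𝓘(ℝ, W) f q) :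
    DifferentiableAt ℝ (f ∘ (extChartAt J p).symm) (extChartAt J p q) := by
  have hq' : q ∈ (extChartAt J p).source := by rwa [extChartAt_source]
  have hf' : MDifferentiableAt J 𝓘(ℝ, W) f ((extChartAt J p).symm (extChartAt J p q)) := by
    rwa [(extChartAt J p).left_inv hq']
  exact (hf'.comp _ ((contMDiffAt_extChartAt_symm
    ((extChartAt J p).map_source hq')).mdifferentiableAt (by simp))).differentiableAt

theorem differentiableAt_fieldInChart {X : ∀ q : N, TangentSpace J q} {p q : N}
    (hq : q ∈ (chartAt HN p).source)
    (hX : MDifferentiableAt J J.tangent (fun q => (⟨q, X q⟩ : TangentBundle J N)) q) :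
    DifferentiableAt ℝ (fieldInChart X p) (extChartAt J p q) := by
  have hm : (⟨q, X q⟩ : TangentBundle J N) ∈ (trivializationAt V (TangentSpace J) p).source :=
    (Trivialization.mem_source _).2 hq
  have h := (((trivializationAt V (TangentSpace J) p).mdifferentiableAt_totalSpace_iff J
    (fun q => (⟨q, X q⟩ : TangentBundle J N)) hm).1 hX).2
  refine differentiableAt_comp_symm (f := fun r => chartD J p r (X r)) hq
    (h.congr_of_eventuallyEq ?_)
  filter_upwards [(chartAt HN p).open_source.mem_nhds hq] with r hr
  rw [trivializationAt_tangent_apply hr]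

omit [J.Boundaryless] in
theorem contMDiffAt_chartDSymm {p q : N} (hq : q ∈ (chartAt HN p).source) (v : V) :
    ContMDiffAt J J.tangent ∞ (fun r => (⟨r, chartDSymm J p r v⟩ : TangentBundle J N)) q := by
  rw [contMDiffAt_field_iff le_rfl hq]
  refine (contMDiffAt_const (c := v)).congr_of_eventuallyEq ?_
  filter_upwards [(chartAt HN p).open_source.mem_nhds hq] with r hr
  exact chartD_chartDSymm hr v

omit [J.Boundaryless] in
/-- Every tangent vector is the value of a smooth vector field on the whole manifold that is
constant in a given chart near the base point. -/
theorem exists_isSmoothField_eventuallyEq_chartDSymm [FiniteDimensional ℝ V] [T2Space N]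
    {p q : N} (hq : q ∈ (chartAt HN p).source) (v : V) :
    ∃ X : ∀ r : N, TangentSpace J r, IsSmoothField J X ∧
      ∀ᶠ r in 𝓝 q, X r = chartDSymm J p r v := by
  obtain ⟨f, -, hf⟩ := (SmoothBumpFunction.nhds_basis_tsupport (I := J) q).mem_iff.1
    ((chartAt HN p).open_source.mem_nhds hq)
  refine ⟨(f : N → ℝ) • fun r => chartDSymm J p r v, ?_, ?_⟩
  · exact ContMDiffOn.smul_section_of_tsupport f.contMDiff.contMDiffOn (chartAt HN p).open_source hf
      fun r hr => (contMDiffAt_chartDSymm hr v).contMDiffWithinAt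
  · filter_upwards [f.eventuallyEq_one] with r hr
    simp [hr]

omit [J.Boundaryless] in
/-- A field of endomorphisms is smooth iff its matrix in a chart is. -/
theorem contMDiffAt_endomorphism_iff {A : ∀ q : N, TangentSpace J q →L[ℝ] TangentSpace J q}
    {p q : N} (hq : q ∈ (chartAt HN p).source) :
    ContMDiffAt J (J.prod 𝓘(ℝ, V →L[ℝ] V)) ∞
      (fun r => TotalSpace.mk' (V →L[ℝ] V)
        (E := fun r : N => TangentSpace J r →L[ℝ] TangentSpace J r) r (A r)) q ↔
    ContMDiffAt J 𝓘(ℝ, V →L[ℝ] V) ∞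
      (fun r => chartD J p r ∘L A r ∘L chartDSymm J p r) q := by
  set e := trivializationAt (V →L[ℝ] V)
    (fun r : N => TangentSpace J r →L[ℝ] TangentSpace J r) p
  have hm : (TotalSpace.mk' (V →L[ℝ] V)
      (E := fun r : N => TangentSpace J r →L[ℝ] TangentSpace J r) q (A q)) ∈ e.source :=
    (Trivialization.mem_source _).2 ⟨hq, hq⟩
  refine (e.contMDiffAt_iff (f := fun r => TotalSpace.mk' (V →L[ℝ] V)
        (E := fun r : N => TangentSpace J r →L[ℝ] TangentSpace J r) r (A r)) hm).trans
    ((and_iff_right contMDiffAt_id).trans ?_)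
  refine Filter.EventuallyEq.contMDiffAt_iff ?_
  refine .of_forall fun r => ?_
  dsimp only [e]
  rw [hom_trivializationAt_apply]
  rfl

omit [J.Boundaryless] in
theorem contMDiffAt_bilinear_of_chart {B : ∀ q : N, TangentSpace J q →L[ℝ] TangentSpace J q →L[ℝ] ℝ}
    {p : N} {b : N → V →L[ℝ] V →L[ℝ] ℝ} (hb : ContMDiffAt J 𝓘(ℝ, V →L[ℝ] V →L[ℝ] ℝ) ∞ b p)
    (hB : ∀ᶠ q in 𝓝 p, ∀ u v, B q u v = b q (chartD J p q u) (chartD J p q v)) :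
    ContMDiffAt J (J.prod 𝓘(ℝ, V →L[ℝ] V →L[ℝ] ℝ)) ∞
      (fun q => TotalSpace.mk' (V →L[ℝ] V →L[ℝ] ℝ)
        (E := fun q : N => TangentSpace J q →L[ℝ] TangentSpace J q →L[ℝ] ℝ) q (B q)) p := by
  rw [contMDiffAt_section]
  refine hb.congr_of_eventuallyEq ?_
  filter_upwards [hB, (chartAt HN p).open_source.mem_nhds (mem_chart_source HN p)] with r hr hrs
  rw [hom_trivializationAt_apply]
  ext v w
  have hsymm : ∀ z : V, (trivializationAt V (TangentSpace J) p).symm r z = chartDSymm J p r z :=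
    fun z => ((trivializationAt V (TangentSpace J) p).symmL_apply hrs z).symm
  refine (inCoordinates_apply_eq₂ (F₁ := V) (F₂ := V) (E₁ := TangentSpace J) (E₂ := TangentSpace J)
    (E₃ := Bundle.Trivial N ℝ) (x₀ := p) hrs hrs (mem_univ _)).trans ?_
  rw [hsymm, hsymm]
  have hv := hr (chartDSymm J p r v) (chartDSymm J p r w)
  rw [chartD_chartDSymm hrs, chartD_chartDSymm hrs] at hv
  rw [← hv, Trivialization.coe_linearMapAt_of_mem _ (mem_univ _)]
  rfl

/-- The exterior derivative of a form can be computed in the chart around any nearby point: it is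
the pull-back of the exterior derivative of the form read in that chart. -/
theorem mExtDeriv_eq_of_formInChart_eqOn {n : ℕ} {η : ∀ q : N, TangentSpace J q [⋀^Fin n]→L[ℝ] ℝ}
    {p q : N} (hq : q ∈ (chartAt HN p).source) {τ : V → V [⋀^Fin n]→L[ℝ] ℝ}
    (hτ : DifferentiableAt ℝ τ (extChartAt J p q))
    (h : ∀ r ∈ (chartAt HN p).source, η r = (τ (extChartAt J p r)).compContinuousLinearMap
      (chartD J p r)) :
    mExtDeriv J η q
      = (extDeriv τ (extChartAt J p q)).compContinuousLinearMap (chartD J p q) := by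
  have hqs : extChartAt J q q ∈ (extChartAt J q).target := mem_extChartAt_target q
  have hl : (extChartAt J q).symm (extChartAt J q q) = q := extChartAt_to_inv q
  have hopen : IsOpen ((extChartAt J q).symm.source ∩
      (extChartAt J q).symm ⁻¹' (chartAt HN p).source) :=
    (continuousOn_extChartAt_symm q).isOpen_inter_preimage (isOpen_extChartAt_target q)
      (chartAt HN p).open_source
  have hmem : ∀ᶠ y in 𝓝 (extChartAt J q q), y ∈ (extChartAt J q).target ∧
      (extChartAt J q).symm y ∈ (chartAt HN p).source :=
    hopen.mem_nhds ⟨hqs, by rw [mem_preimage, hl]; exact hq⟩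
  have hform : formInChart J η q =ᶠ[𝓝 (extChartAt J q q)] fun y =>
      (τ ((extChartAt J p ∘ (extChartAt J q).symm) y)).compContinuousLinearMap
        (fderiv ℝ (extChartAt J p ∘ (extChartAt J q).symm) y) := by
    filter_upwards [hmem] with y ⟨hy, hyp⟩
    ext v
    have hd : mfderivWithin 𝓘(ℝ, V) J (extChartAt J q).symm (range J) y
        = chartDSymm J q ((extChartAt J q).symm y) := by
      rw [chartDSymm_eq_mfderivWithin (symm_mem_source hy), (extChartAt J q).right_inv hy]
    rw [formInChart, hd, h _ hyp]
    simp only [ContinuousAlternatingMap.compContinuousLinearMap_apply]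
    congr 1
    ext i
    exact (fderiv_extChartAt_comp_symm hy hyp (v i)).symm
  have hsmooth : ContDiffAt ℝ ∞ (extChartAt J p ∘ (extChartAt J q).symm) (extChartAt J q q) :=
    contDiffAt_comp_symm le_rfl hqs (contMDiffAt_extChartAt' (by rwa [hl]))
  have hval : (extChartAt J p ∘ (extChartAt J q).symm) (extChartAt J q q) = extChartAt J p q := by
    rw [Function.comp_apply, hl]
  rw [mExtDeriv, J.range_eq_univ, extDerivWithin_univ, hform.extDeriv_eq,
    extDeriv_pullback (by rwa [hval]) hsmooth
      (by simpa using (ENat.LEInfty.out : (2 : ℕ∞ω) ≤ ∞)), hval]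
  ext v
  refine congrArg (extDeriv τ (extChartAt J p q)) (funext fun i => ?_)
  have hcongr : ∀ r (hr : r = q) (w : V), chartD J p r (chartDSymm J q r w)
      = chartD J p q (chartDSymm J q q w) := by
    rintro _ rfl _
    rfl
  refine (fderiv_extChartAt_comp_symm hqs (by rwa [hl]) _).trans ((hcongr _ hl _).trans ?_)
  refine congrArg (chartD J p q) (Eq.trans ?_ (chartDSymm_chartD (mem_chart_source HN q) (v i)))
  exact congrArg (fun L : TangentSpace J q →L[ℝ] V => chartDSymm J q q (L (v i)))
    (chartD_eq_mfderiv (mem_chart_source HN q)).symm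

omit [J.Boundaryless] in
/-- The velocity of a curve read in a chart is the derivative of the curve read in that chart. -/
theorem hasDerivAt_extChartAt_comp {c : ℝ → N} {t : ℝ} {p : N}
    (hq : c t ∈ (chartAt HN p).source) (hc : MDifferentiableAt 𝓘(ℝ, ℝ) J c t) :
    HasDerivAt (fun s => extChartAt J p (c s))
      (chartD J p (c t) (mfderiv 𝓘(ℝ, ℝ) J c t (1 : ℝ))) t := by
  have h := (mdifferentiableAt_extChartAt hq).hasMFDerivAt.comp t hc.hasMFDerivAt
  rw [chartD_eq_mfderiv hq]
  have h' : HasFDerivAt (fun s => extChartAt J p (c s))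
      ((show V →L[ℝ] V from mfderiv J 𝓘(ℝ, V) (extChartAt J p) (c t)) ∘L
        (show ℝ →L[ℝ] V from mfderiv 𝓘(ℝ, ℝ) J c t)) t := hasMFDerivAt_iff_hasFDerivAt.1 h
  exact h'.hasDerivAt

omit [J.Boundaryless] in
/-- A field of bilinear forms that reads `(u, v) ↦ S(A u, v)` in every preferred chart, for a
constant bilinear form `S` and smooth endomorphisms `A`, is smooth. -/
theorem contMDiff_bilinear_of_chart
    {B : ∀ q : N, TangentSpace J q →L[ℝ] TangentSpace J q →L[ℝ] ℝ} (S : V →L[ℝ] V →L[ℝ] ℝ)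
    {A : N → N → V →L[ℝ] V} (hA : ∀ p, ContMDiffAt J 𝓘(ℝ, V →L[ℝ] V) ∞ (A p) p)
    (hB : ∀ p, ∀ q ∈ (chartAt HN p).source, ∀ u v,
      B q u v = S (A p q (chartD J p q u)) (chartD J p q v)) :
    ContMDiff J (J.prod 𝓘(ℝ, V →L[ℝ] V →L[ℝ] ℝ)) ∞
      (fun q => TotalSpace.mk' (V →L[ℝ] V →L[ℝ] ℝ)
        (E := fun q : N => TangentSpace J q →L[ℝ] TangentSpace J q →L[ℝ] ℝ) q (B q)) := by
  intro p
  refine contMDiffAt_bilinear_of_chart (b := fun q => S ∘L A p q)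
    (contMDiffAt_const.clm_comp (hA p)) ?_
  filter_upwards [(chartAt HN p).open_source.mem_nhds (mem_chart_source HN p)] with q hq
  exact hB p q hq

omit [J.Boundaryless] in
theorem contMDiff_bilinear_apply_of_chart {f : N → ℝ} (S : V →L[ℝ] V →L[ℝ] ℝ)
    {X Y : ∀ q : N, TangentSpace J q} (hX : IsSmoothField J X) (hY : IsSmoothField J Y)
    (hf : ∀ p, ∀ q ∈ (chartAt HN p).source, f q = S (chartD J p q (X q)) (chartD J p q (Y q))) :
    ContMDiff J 𝓘(ℝ, ℝ) ∞ f := by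
  intro p
  have hp := mem_chart_source HN p
  refine ContMDiffAt.congr_of_eventuallyEq ((contMDiffAt_const (c := S)).clm_apply
    ((contMDiffAt_field_iff le_rfl hp).1 (hX p)) |>.clm_apply
      ((contMDiffAt_field_iff le_rfl hp).1 (hY p))) ?_
  filter_upwards [(chartAt HN p).open_source.mem_nhds hp] with q hq
  exact hf p q hq

/-- A differential form with constant coefficients in every preferred chart is closed. -/
theorem mExtDeriv_eq_zero_of_const {n : ℕ}
    {η : ∀ q : N, TangentSpace J q [⋀^Fin n]→L[ℝ] ℝ} (τ : V [⋀^Fin n]→L[ℝ] ℝ)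
    (h : ∀ p, ∀ q ∈ (chartAt HN p).source, η q = τ.compContinuousLinearMap (chartD J p q)) (p : N) :
    mExtDeriv J η p = 0 := by
  have hc : extDeriv (fun _ : V => τ) (extChartAt J p p) = 0 := by
    rw [extDeriv, fderiv_const_apply]
    exact (ContinuousAlternatingMap.alternatizeUncurryFinCLM ℝ V ℝ).map_zero
  rw [mExtDeriv_eq_of_formInChart_eqOn (mem_chart_source HN p) (τ := fun _ => τ)
    (differentiableAt_const _) (h p), hc]
  rfl

end ChartReading

/-! ### Eigenbundles of para-complex structures -/

section Involutive

variable {V : Type*} [NormedAddCommGroup V] [NormedSpace ℝ V]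
  {HN : Type*} [TopologicalSpace HN] {J : ModelWithCorners ℝ V HN}
  {N : Type*} [TopologicalSpace N] [ChartedSpace HN N] [IsManifold J ∞ N]
  {K : ∀ p : N, TangentSpace J p →L[ℝ] TangentSpace J p}

omit [IsManifold J ∞ N] in
theorem mem_eigenPlus {p : N} {u : TangentSpace J p} : u ∈ eigenPlus J K p ↔ K p u = u :=
  sub_eq_zero

omit [IsManifold J ∞ N] in
theorem mem_eigenMinus {p : N} {u : TangentSpace J p} : u ∈ eigenMinus J K p ↔ K p u = -u :=
  add_eq_zero_iff_eq_neg

/-- On sections of `E₊` the Nijenhuis tensor is `2([X, Y] - K[X, Y])`. -/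
theorem IsParaComplex.isInvolutive_eigenPlus (hK : IsParaComplex J K) :
    IsInvolutive J (eigenPlus J K) := by
  intro X Y hX hY hXe hYe p
  have h := hK.nijenhuis X Y hX hY p
  rw [show (fun q => K q (X q)) = X from funext fun q => mem_eigenPlus.1 (hXe q),
    show (fun q => K q (Y q)) = Y from funext fun q => mem_eigenPlus.1 (hYe q)] at h
  rw [mem_eigenPlus, eq_comm, ← sub_eq_zero]
  have h2 : (2 : ℝ) • (mlieBracket J X Y p - K p (mlieBracket J X Y p)) = 0 := by
    rw [two_smul, ← h]
    abel
  exact (smul_eq_zero.1 h2).resolve_left two_ne_zero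

/-- On sections of `E₋` the Nijenhuis tensor is `2([X, Y] + K[X, Y])`. -/
theorem IsParaComplex.isInvolutive_eigenMinus [CompleteSpace V] (hK : IsParaComplex J K) :
    IsInvolutive J (eigenMinus J K) := by
  intro X Y hX hY hXe hYe p
  have : IsManifold J 2 N := .of_le (n := ∞) (ENat.LEInfty.out : (2 : ℕ∞ω) ≤ ∞)
  have h := hK.nijenhuis X Y hX hY p
  have hXd := hX.contMDiffAt.mdifferentiableAt (x := p) (by simp)
  have hYd := hY.contMDiffAt.mdifferentiableAt (x := p) (by simp)
  rw [show (fun q => K q (X q)) = (-1 : ℝ) • X from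
      funext fun q => (mem_eigenMinus.1 (hXe q)).trans (neg_one_smul ℝ (X q)).symm,
    show (fun q => K q (Y q)) = (-1 : ℝ) • Y from
      funext fun q => (mem_eigenMinus.1 (hYe q)).trans (neg_one_smul ℝ (Y q)).symm,
    mlieBracket_const_smul_left hXd, mlieBracket_const_smul_right hYd,
    mlieBracket_const_smul_left hXd, map_smul] at h
  rw [mem_eigenMinus, ← add_eq_zero_iff_eq_neg]
  have h2 : (2 : ℝ) • (K p (mlieBracket J X Y p) + mlieBracket J X Y p) = 0 := by
    rw [two_smul, ← h]
    module
  exact (smul_eq_zero.1 h2).resolve_left two_ne_zero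

end Involutive

/-! ### The model `E × E*` -/

section GraphReflection

variable {A B Z : Type*} [NormedAddCommGroup A] [NormedSpace ℝ A] [NormedAddCommGroup B]
  [NormedSpace ℝ B] [NormedAddCommGroup Z] [NormedSpace ℝ Z]
  {P Q : Type*} [NormedAddCommGroup P] [NormedSpace ℝ P] [NormedAddCommGroup Q] [NormedSpace ℝ Q]

theorem ContDiffAt.clm_comp_prod {c : P →L[ℝ] Q →L[ℝ] B} {Γ : Z → A →L[ℝ] Q} {z : Z × P}
    {n : ℕ∞ω} (hΓ : ContDiffAt ℝ n Γ z.1) :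
    ContDiffAt ℝ n (fun y : Z × P => c y.2 ∘L Γ y.1) z :=
  (c.contDiff.contDiffAt.comp z contDiffAt_snd).clm_comp (hΓ.comp z contDiffAt_fst)

theorem fderiv_clm_comp_prod_apply {c : P →L[ℝ] Q →L[ℝ] B} {Γ : Z → A →L[ℝ] Q} {z : Z × P}
    (hΓ : DifferentiableAt ℝ Γ z.1) (d : Z × P) (v : A) :
    fderiv ℝ (fun y : Z × P => c y.2 ∘L Γ y.1) z d v
      = c d.2 (Γ z.1 v) + c z.2 (fderiv ℝ Γ z.1 d.1 v) := by
  have hc : HasFDerivAt (fun y : Z × P => c y.2) (c ∘L ContinuousLinearMap.snd ℝ Z P) z :=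
    c.hasFDerivAt.comp z hasFDerivAt_snd
  have hΓ' : HasFDerivAt (fun y : Z × P => Γ y.1)
      (fderiv ℝ Γ z.1 ∘L ContinuousLinearMap.fst ℝ Z P) z :=
    hΓ.hasFDerivAt.comp z hasFDerivAt_fst
  rw [(hc.clm_comp hΓ').fderiv]
  simp [add_comm]

theorem fderiv_clm_apply_apply {Γ : Z → A →L[ℝ] Q →L[ℝ] B} {z : Z} (hΓ : DifferentiableAt ℝ Γ z)
    (d : Z) (v : A) (w : Q) : fderiv ℝ (fun y => Γ y v w) z d = fderiv ℝ Γ z d v w := by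
  rw [fderiv_clm_apply (hΓ.clm_apply (differentiableAt_const v)) (differentiableAt_const w),
    fderiv_clm_apply hΓ (differentiableAt_const v)]
  simp

theorem differentiable_ofSubsingleton_comp_snd (L : P →L[ℝ] A →L[ℝ] B) :
    Differentiable ℝ fun z : Z × P =>
      ContinuousAlternatingMap.ofSubsingleton ℝ A B (0 : Fin 1) (L z.2) :=
  (ContinuousAlternatingMap.ofSubsingletonLIE
    (0 : Fin 1)).toContinuousLinearEquiv.differentiable.comp
      (L.differentiable.comp differentiable_snd)

/-- The involution of `A × B` that is the identity on the graph of `L` and minus the identity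
on `0 × B`. -/
noncomputable def graphReflection (L : A →L[ℝ] B) : (A × B) →L[ℝ] (A × B) :=
  (ContinuousLinearMap.fst ℝ A B).prod
    ((2 : ℝ) • (L ∘L ContinuousLinearMap.fst ℝ A B) - ContinuousLinearMap.snd ℝ A B)

theorem graphReflection_apply (L : A →L[ℝ] B) (u : A × B) :
    graphReflection L u = (u.1, (2 : ℝ) • L u.1 - u.2) := rfl

theorem contDiff_graphReflection {n : ℕ∞ω} :
    ContDiff ℝ n (graphReflection : (A →L[ℝ] B) → (A × B) →L[ℝ] (A × B)) := by
  have h : (graphReflection : (A →L[ℝ] B) → (A × B) →L[ℝ] (A × B)) = fun L =>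
      ContinuousLinearMap.inl ℝ A B ∘L ContinuousLinearMap.fst ℝ A B
        + ContinuousLinearMap.inr ℝ A B ∘L ((2 : ℝ) • (L ∘L ContinuousLinearMap.fst ℝ A B)
          - ContinuousLinearMap.snd ℝ A B) := by
    ext1 L
    refine ContinuousLinearMap.ext fun u => ?_
    simp [graphReflection_apply]
  rw [h]
  exact contDiff_const.add (contDiff_const.clm_comp
    (((contDiff_id.clm_comp contDiff_const).const_smul (2 : ℝ)).sub contDiff_const))

theorem fderiv_graphReflection_comp_apply {L : Z → A →L[ℝ] B} {z : Z}
    (hL : DifferentiableAt ℝ L z) (d : Z) (u : A × B) :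
    fderiv ℝ (fun y => graphReflection (L y)) z d u = (0, (2 : ℝ) • fderiv ℝ L z d u.1) := by
  have hR : DifferentiableAt ℝ (fun y => graphReflection (L y)) z :=
    ((contDiff_graphReflection (A := A) (B := B) (n := 1)).differentiable
      (by simp)).differentiableAt.comp z hL
  have h1 : fderiv ℝ (fun y => graphReflection (L y)) z d u
      = fderiv ℝ (fun y => graphReflection (L y) u) z d := by
    rw [fderiv_clm_apply hR (differentiableAt_const u)]
    simp
  have h2 : HasFDerivAt (fun y => (u.1, (2 : ℝ) • L y u.1 - u.2)) _ z :=
    (hasFDerivAt_const (𝕜 := ℝ) u.1 z).prodMk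
      (((hL.hasFDerivAt.clm_apply (hasFDerivAt_const u.1 z)).const_smul (2 : ℝ)).sub
        (hasFDerivAt_const u.2 z))
  simp only [graphReflection_apply] at h1
  rw [h1, HasFDerivAt.fderiv h2]
  exact Prod.ext (by simp) (by simp)

end GraphReflection

section Model

variable {E : Type*} [NormedAddCommGroup E] [NormedSpace ℝ E]

/-- The symplectic form `((v, a), (w, b)) ↦ b(v) - a(w)` of `E × E*`. -/
noncomputable def modelSymplectic :
    (E × (E →L[ℝ] ℝ)) →L[ℝ] (E × (E →L[ℝ] ℝ)) →L[ℝ] ℝ :=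
  let A : (E × (E →L[ℝ] ℝ)) →L[ℝ] (E × (E →L[ℝ] ℝ)) →L[ℝ] ℝ :=
    (ContinuousLinearMap.compL ℝ (E × (E →L[ℝ] ℝ)) E ℝ).flip
      (ContinuousLinearMap.fst ℝ E (E →L[ℝ] ℝ)) ∘L ContinuousLinearMap.snd ℝ E (E →L[ℝ] ℝ)
  A.flip - A

@[simp]
theorem modelSymplectic_apply (u v : E × (E →L[ℝ] ℝ)) :
    modelSymplectic u v = v.2 u.1 - u.2 v.1 := rfl

theorem eq_zero_of_modelSymplectic_eq_zero {u : E × (E →L[ℝ] ℝ)}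
    (h : ∀ v, modelSymplectic u v = 0) : u = 0 := by
  have h1 : u.1 = 0 := by
    refine SeparatingDual.eq_zero_of_forall_dual_eq_zero (R := ℝ) fun b => ?_
    simpa using h (0, b)
  have h2 : u.2 = 0 := by
    ext w
    simpa using h (w, 0)
  exact Prod.ext h1 h2

/-- The tautological one-form `p dx` of `E × E*`, where `p` is the second coordinate. -/
noncomputable def modelTautological (z : E × (E →L[ℝ] ℝ)) :
    (E × (E →L[ℝ] ℝ)) [⋀^Fin 1]→L[ℝ] ℝ :=
  ContinuousAlternatingMap.ofSubsingleton ℝ (E × (E →L[ℝ] ℝ)) ℝ (0 : Fin 1)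
    (z.2.comp (ContinuousLinearMap.fst ℝ E (E →L[ℝ] ℝ)))

theorem modelTautological_apply (z : E × (E →L[ℝ] ℝ)) (m : Fin 1 → E × (E →L[ℝ] ℝ)) :
    modelTautological z m = z.2 (m 0).1 := rfl

theorem differentiable_modelTautological :
    Differentiable ℝ (modelTautological : E × (E →L[ℝ] ℝ) → _) :=
  differentiable_ofSubsingleton_comp_snd
    ((ContinuousLinearMap.compL ℝ (E × (E →L[ℝ] ℝ)) E ℝ).flip
      (ContinuousLinearMap.fst ℝ E (E →L[ℝ] ℝ)))

/-- `-d(p dx)` is the standard symplectic form. -/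
theorem extDeriv_modelTautological (z : E × (E →L[ℝ] ℝ)) (m : Fin 2 → E × (E →L[ℝ] ℝ)) :
    extDeriv modelTautological z m = -modelSymplectic (m 0) (m 1) := by
  rw [extDeriv_apply differentiable_modelTautological.differentiableAt]
  have h : ∀ (n : Fin 1 → E × (E →L[ℝ] ℝ)) (d : E × (E →L[ℝ] ℝ)),
      fderiv ℝ (fun z : E × (E →L[ℝ] ℝ) => modelTautological z n) z d = d.2 (n 0).1 := by
    intro n d
    have h1 : (fun z : E × (E →L[ℝ] ℝ) => modelTautological z n)
        = (ContinuousLinearMap.apply ℝ ℝ (n 0).1 ∘L ContinuousLinearMap.snd ℝ E (E →L[ℝ] ℝ)) := rfl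
    rw [h1, ContinuousLinearMap.fderiv]
    rfl
  simp only [h]
  simp [Fin.removeNth]
  ring

/-- The horizontal space at `z = (x, p)` is the graph `{(v, p ∘ Γ_x(v))}` of this map. -/
noncomputable def horizontalLift (Γ : E → E →L[ℝ] E →L[ℝ] E) (z : E × (E →L[ℝ] ℝ)) :
    E →L[ℝ] E →L[ℝ] ℝ :=
  ContinuousLinearMap.compL ℝ E E ℝ z.2 ∘L Γ z.1

@[simp]
theorem horizontalLift_apply (Γ : E → E →L[ℝ] E →L[ℝ] E) (z : E × (E →L[ℝ] ℝ)) (v : E) :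
    horizontalLift Γ z v = z.2.comp (Γ z.1 v) := rfl

theorem ContDiffAt.horizontalLift {Γ : E → E →L[ℝ] E →L[ℝ] E} {z : E × (E →L[ℝ] ℝ)} {n : ℕ∞ω}
    (hΓ : ContDiffAt ℝ n Γ z.1) : ContDiffAt ℝ n (horizontalLift Γ) z :=
  ContDiffAt.clm_comp_prod hΓ

theorem fderiv_horizontalLift_apply {Γ : E → E →L[ℝ] E →L[ℝ] E} {z : E × (E →L[ℝ] ℝ)}
    (hΓ : DifferentiableAt ℝ Γ z.1) (d : E × (E →L[ℝ] ℝ)) (v : E) :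
    fderiv ℝ (horizontalLift Γ) z d v
      = d.2.comp (Γ z.1 v) + z.2.comp (fderiv ℝ Γ z.1 d.1 v) :=
  fderiv_clm_comp_prod_apply hΓ d v

/-- The endomorphism of `E × E*` that is the identity on the horizontal space
`{(v, p ∘ Γ_x(v))}` at `z = (x, p)` and minus the identity on `0 × E*`. -/
noncomputable def modelParacomplex (Γ : E → E →L[ℝ] E →L[ℝ] E) (z : E × (E →L[ℝ] ℝ)) :
    (E × (E →L[ℝ] ℝ)) →L[ℝ] (E × (E →L[ℝ] ℝ)) :=
  graphReflection (horizontalLift Γ z)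

@[simp]
theorem modelParacomplex_apply (Γ : E → E →L[ℝ] E →L[ℝ] E) (z u : E × (E →L[ℝ] ℝ)) :
    modelParacomplex Γ z u = (u.1, (2 : ℝ) • z.2.comp (Γ z.1 u.1) - u.2) := rfl

theorem modelParacomplex_modelParacomplex (Γ : E → E →L[ℝ] E →L[ℝ] E) (z u : E × (E →L[ℝ] ℝ)) :
    modelParacomplex Γ z (modelParacomplex Γ z u) = u := by
  simp

theorem ContDiffAt.modelParacomplex {Γ : E → E →L[ℝ] E →L[ℝ] E} {z : E × (E →L[ℝ] ℝ)} {n : ℕ∞ω}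
    (hΓ : ContDiffAt ℝ n Γ z.1) : ContDiffAt ℝ n (modelParacomplex Γ) z :=
  (contDiff_graphReflection (A := E) (B := E →L[ℝ] ℝ)).contDiffAt.comp z hΓ.horizontalLift

theorem fderiv_modelParacomplex_apply {Γ : E → E →L[ℝ] E →L[ℝ] E} {z : E × (E →L[ℝ] ℝ)}
    (hΓ : ContDiffAt ℝ ∞ Γ z.1) (d u : E × (E →L[ℝ] ℝ)) :
    fderiv ℝ (modelParacomplex Γ) z d u
      = (0, (2 : ℝ) • (d.2.comp (Γ z.1 u.1) + z.2.comp (fderiv ℝ Γ z.1 d.1 u.1))) := by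
  have hL : DifferentiableAt ℝ (horizontalLift Γ) z :=
    hΓ.horizontalLift.differentiableAt (by simp)
  rw [← fderiv_horizontalLift_apply (hΓ.differentiableAt (by simp))]
  exact fderiv_graphReflection_comp_apply hL d u

/-- The Nijenhuis tensor of an involution `K`, expressed by the differential of `K`. -/
theorem nijenhuis_eq_fderiv {W : Type*} [NormedAddCommGroup W] [NormedSpace ℝ W]
    {K : W → W →L[ℝ] W} {X Y : W → W} {z : W} (hK : DifferentiableAt ℝ K z)
    (hX : DifferentiableAt ℝ X z) (hY : DifferentiableAt ℝ Y z) (hsq : ∀ u, K z (K z u) = u) :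
    lieBracket ℝ X Y z + lieBracket ℝ (fun y => K y (X y)) (fun y => K y (Y y)) z
        - K z (lieBracket ℝ (fun y => K y (X y)) Y z)
        - K z (lieBracket ℝ X (fun y => K y (Y y)) z)
      = fderiv ℝ K z (K z (X z)) (Y z) - fderiv ℝ K z (K z (Y z)) (X z)
        + K z (fderiv ℝ K z (Y z) (X z)) - K z (fderiv ℝ K z (X z) (Y z)) := by
  have hd : ∀ {Z : W → W}, DifferentiableAt ℝ Z z → ∀ u,
      fderiv ℝ (fun y => K y (Z y)) z u = K z (fderiv ℝ Z z u) + fderiv ℝ K z u (Z z) := by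
    intro Z hZ u
    rw [fderiv_clm_apply hK hZ]
    simp
  simp only [lieBracket_eq, hd hX, hd hY, map_sub, map_add, hsq]
  abel

/-- The Nijenhuis tensor of `modelParacomplex Γ` is the curvature of `Γ`. -/
theorem nijenhuis_modelParacomplex_eq_zero {Γ : E → E →L[ℝ] E →L[ℝ] E} {z : E × (E →L[ℝ] ℝ)}
    (hΓ : ContDiffAt ℝ ∞ Γ z.1)
    (hflat : ∀ v w u, fderiv ℝ Γ z.1 v w u + Γ z.1 v (Γ z.1 w u)
      = fderiv ℝ Γ z.1 w v u + Γ z.1 w (Γ z.1 v u))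
    {X Y : E × (E →L[ℝ] ℝ) → E × (E →L[ℝ] ℝ)}
    (hX : DifferentiableAt ℝ X z) (hY : DifferentiableAt ℝ Y z) :
    lieBracket ℝ X Y z
        + lieBracket ℝ (fun y => modelParacomplex Γ y (X y)) (fun y => modelParacomplex Γ y (Y y)) z
        - modelParacomplex Γ z (lieBracket ℝ (fun y => modelParacomplex Γ y (X y)) Y z)
        - modelParacomplex Γ z (lieBracket ℝ X (fun y => modelParacomplex Γ y (Y y)) z) = 0 := by
  have hK : DifferentiableAt ℝ (modelParacomplex Γ) z :=
    hΓ.modelParacomplex.differentiableAt (by simp)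
  rw [nijenhuis_eq_fderiv hK hX hY (modelParacomplex_modelParacomplex Γ z)]
  simp only [fderiv_modelParacomplex_apply hΓ,
    modelParacomplex_apply]
  refine Prod.ext (by simp) ?_
  ext u
  have h := congrArg z.2 (hflat (X z).1 (Y z).1 u)
  simp only [map_add] at h
  simp
  linarith

theorem modelParacomplex_eq_self_iff (Γ : E → E →L[ℝ] E →L[ℝ] E) (z u : E × (E →L[ℝ] ℝ)) :
    modelParacomplex Γ z u = u ↔ u.2 = horizontalLift Γ z u.1 := by
  rw [modelParacomplex_apply, Prod.ext_iff, horizontalLift_apply]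
  simp only [true_and]
  rw [sub_eq_iff_eq_add, ← two_smul ℝ u.2]
  exact ((smul_right_injective _ (two_ne_zero (α := ℝ))).eq_iff).trans eq_comm

theorem modelParacomplex_eq_neg_iff (Γ : E → E →L[ℝ] E →L[ℝ] E) (z u : E × (E →L[ℝ] ℝ)) :
    modelParacomplex Γ z u = -u ↔ u.1 = 0 := by
  rw [modelParacomplex_apply, Prod.ext_iff]
  refine ⟨fun h => ?_, fun h => ?_⟩
  · have h2 : (2 : ℝ) • u.1 = 0 := by
      rw [two_smul]
      exact eq_neg_iff_add_eq_zero.1 h.1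
    exact (smul_eq_zero.1 h2).resolve_left two_ne_zero
  · simp [h]

/-- If `Γ` is symmetric, then the involution is anti-symplectic. -/
theorem modelSymplectic_modelParacomplex {Γ : E → E →L[ℝ] E →L[ℝ] E} {z : E × (E →L[ℝ] ℝ)}
    (hΓ : ∀ v w, Γ z.1 v w = Γ z.1 w v) (u v : E × (E →L[ℝ] ℝ)) :
    modelSymplectic (modelParacomplex Γ z u) (modelParacomplex Γ z v)
      = -modelSymplectic u v := by
  simp [hΓ v.1 u.1]

end Model

/-! ### Smooth integral curves -/

section ODE

variable {W : Type*} [NormedAddCommGroup W] [NormedSpace ℝ W]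

/-- Integral curves of a smooth vector field are smooth. -/
theorem contDiffOn_of_hasDerivAt {F : W → W} {U : Set W} (hF : ContDiffOn ℝ ∞ F U) {γ : ℝ → W}
    {I : Set ℝ} (hI : IsOpen I) (hγ : ∀ t ∈ I, HasDerivAt γ (F (γ t)) t) (hU : MapsTo γ I U) :
    ContDiffOn ℝ ∞ γ I := by
  rw [contDiffOn_infty]
  intro n
  induction n with
  | zero => exact contDiffOn_zero.2 fun t ht => (hγ t ht).continuousAt.continuousWithinAt
  | succ n ih =>
    refine (contDiffOn_succ_iff_deriv_of_isOpen (n := (n : ℕ∞ω)) hI).2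
      ⟨fun t ht => (hγ t ht).differentiableAt.differentiableWithinAt,
        fun h => absurd h (WithTop.coe_ne_top (a := (n : ℕ∞))), ?_⟩
    exact ((hF.of_le (by exact_mod_cast le_top)).comp ih hU).congr fun t ht => (hγ t ht).deriv

/-- Smooth vector fields have smooth integral curves on a short symmetric interval. -/
theorem exists_contDiffOn_integralCurve [CompleteSpace W] {F : W → W} {U : Set W} (hUo : IsOpen U)
    (hF : ContDiffOn ℝ ∞ F U) {z : W} (hz : z ∈ U) :
    ∃ ε > 0, ∃ γ : ℝ → W, γ 0 = z ∧ MapsTo γ (Ioo (-ε) ε) U ∧ ContDiffOn ℝ ∞ γ (Ioo (-ε) ε) ∧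
      ∀ t ∈ Ioo (-ε) ε, HasDerivAt γ (F (γ t)) t := by
  obtain ⟨γ, hγ0, ε, hε, hγ⟩ :=
    ContDiffAt.exists_forall_mem_closedBall_exists_eq_forall_mem_Ioo_hasDerivAt₀
      ((hF.contDiffAt (hUo.mem_nhds hz)).of_le (by simp)) 0
  simp only [zero_sub, zero_add] at hγ
  have hopen : IsOpen (Ioo (-ε) ε ∩ γ ⁻¹' U) :=
    ContinuousOn.isOpen_inter_preimage
      (fun t ht => (hγ t ht).continuousAt.continuousWithinAt) isOpen_Ioo hUo
  obtain ⟨δ, hδ, hball⟩ := Metric.isOpen_iff.1 hopen 0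
    ⟨by simpa using hε, by rwa [mem_preimage, hγ0]⟩
  rw [Real.ball_eq_Ioo, zero_sub, zero_add] at hball
  have hder : ∀ t ∈ Ioo (-δ) δ, HasDerivAt γ (F (γ t)) t := fun t ht => hγ t (hball ht).1
  exact ⟨δ, hδ, γ, hγ0, fun t ht => (hball ht).2,
    contDiffOn_of_hasDerivAt hF isOpen_Ioo hder fun t ht => (hball ht).2, hder⟩

end ODE

/-! ### Linear algebra of an anti-symplectic involution -/

section Involution

variable {W : Type*} [AddCommGroup W] [Module ℝ W]

theorem isCompl_of_involution {K : W →ₗ[ℝ] W} (hK : ∀ u, K (K u) = u) {L L' : Submodule ℝ W}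
    (hL : ∀ u, u ∈ L ↔ K u = u) (hL' : ∀ u, u ∈ L' ↔ K u = -u) : IsCompl L L' := by
  constructor
  · rw [Submodule.disjoint_def]
    intro u hu hu'
    have h : u = -u := ((hL u).1 hu).symm.trans ((hL' u).1 hu')
    have h2 : (2 : ℝ) • u = 0 := by rw [two_smul, ← eq_neg_iff_add_eq_zero, ← h]
    exact (smul_eq_zero.1 h2).resolve_left two_ne_zero
  · rw [codisjoint_iff, Submodule.eq_top_iff']
    intro u
    refine Submodule.mem_sup.2 ⟨(2⁻¹ : ℝ) • (u + K u), ?_, (2⁻¹ : ℝ) • (u - K u), ?_, by module⟩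
    · rw [hL, map_smul, map_add, hK, add_comm]
    · rw [hL', map_smul, map_sub, hK]
      module

/-- A 2-form as a bilinear map. -/
def bilinOfTwoForm [TopologicalSpace W] (Ω : W [⋀^Fin 2]→L[ℝ] ℝ) : W →ₗ[ℝ] W →ₗ[ℝ] ℝ :=
  have h0 : ∀ u v x : W, Function.update ![u, v] 0 x = ![x, v] := fun u v x => by
    ext i
    fin_cases i <;> rfl
  have h1 : ∀ u v x : W, Function.update ![u, v] 1 x = ![u, x] := fun u v x => by
    ext i
    fin_cases i <;> rfl
  LinearMap.mk₂ ℝ (fun u v => Ω ![u, v])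
    (fun u u' v => by simpa only [h0] using Ω.map_update_add ![u, v] 0 u u')
    (fun a u v => by simpa only [h0] using Ω.map_update_smul ![u, v] 0 a u)
    (fun u v v' => by simpa only [h1] using Ω.map_update_add ![u, v] 1 v v')
    (fun a u v => by simpa only [h1] using Ω.map_update_smul ![u, v] 1 a v)

variable {K : W →ₗ[ℝ] W} {b : W →ₗ[ℝ] W →ₗ[ℝ] ℝ} {L : Submodule ℝ W}

theorem eq_zero_of_mem_fixed (hb : ∀ u v, b (K u) (K v) = -b u v)
    (hL : ∀ u, u ∈ L ↔ K u = u) {u v : W} (hu : u ∈ L) (hv : v ∈ L) : b u v = 0 := by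
  have h := hb u v
  rw [(hL u).1 hu, (hL v).1 hv] at h
  linarith

/-- The fixed space of an anti-symplectic involution is its own symplectic complement. -/
theorem mem_fixed_iff (hK : ∀ u, K (K u) = u) (hb : ∀ u v, b (K u) (K v) = -b u v)
    (hnd : ∀ u, (∀ v, b u v = 0) → u = 0) (hL : ∀ u, u ∈ L ↔ K u = u) (u : W) :
    u ∈ L ↔ ∀ v ∈ L, b u v = 0 := by
  refine ⟨fun hu v hv => eq_zero_of_mem_fixed hb hL hu hv, fun h => ?_⟩
  rw [hL, ← sub_eq_zero]
  refine hnd _ fun w => ?_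
  have h1 := h (w + K w) ((hL _).2 (by rw [map_add, hK, add_comm]))
  have h2 := hb u (K w)
  rw [hK] at h2
  rw [map_add] at h1
  rw [map_sub, LinearMap.sub_apply]
  linarith

/-- The form `b` pairs the fixed space with the antifixed space, and the map from the former to the
dual of the latter is injective because `b` vanishes on the former. -/
theorem finrank_fixed_le [FiniteDimensional ℝ W] (hK : ∀ u, K (K u) = u)
    (hb : ∀ u v, b (K u) (K v) = -b u v) (hnd : ∀ u, (∀ v, b u v = 0) → u = 0)
    (hL : ∀ u, u ∈ L ↔ K u = u) {L' : Submodule ℝ W} (hL' : ∀ u, u ∈ L' ↔ K u = -u) :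
    Module.finrank ℝ L ≤ Module.finrank ℝ L' := by
  rw [← Subspace.dual_finrank_eq (K := ℝ) (V := L')]
  refine LinearMap.finrank_le_finrank_of_injective
    (f := (L'.subtype.dualMap : (W →ₗ[ℝ] ℝ) →ₗ[ℝ] _) ∘ₗ b ∘ₗ L.subtype) ?_
  rw [← LinearMap.ker_eq_bot, LinearMap.ker_eq_bot']
  rintro ⟨u, hu⟩ h
  refine Subtype.ext (hnd u fun v => ?_)
  obtain ⟨x, hx, y, hy, rfl⟩ := Submodule.mem_sup.1
    (((isCompl_of_involution hK hL hL').sup_eq_top).symm ▸ Submodule.mem_top : v ∈ L ⊔ L')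
  rw [map_add, eq_zero_of_mem_fixed hb hL hu hx, zero_add]
  exact LinearMap.congr_fun h ⟨y, hy⟩

theorem finrank_fixed_eq [FiniteDimensional ℝ W] (hK : ∀ u, K (K u) = u)
    (hb : ∀ u v, b (K u) (K v) = -b u v) (hnd : ∀ u, (∀ v, b u v = 0) → u = 0)
    (hL : ∀ u, u ∈ L ↔ K u = u) {L' : Submodule ℝ W} (hL' : ∀ u, u ∈ L' ↔ K u = -u) :
    Module.finrank ℝ L = Module.finrank ℝ L' := by
  refine le_antisymm (finrank_fixed_le hK hb hnd hL hL') (finrank_fixed_le (K := -K) (b := b)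
    (by simpa using hK) (by simpa using hb) hnd ?_ ?_)
  · intro u
    rw [hL', LinearMap.neg_apply, neg_eq_iff_eq_neg]
  · intro u
    rw [hL, LinearMap.neg_apply, neg_inj]

/-- The fixed space is maximal isotropic for `b(K·, ·)`: a vector orthogonal to it lies in it,
because it is its own complement for `b`. -/
theorem isMaximalIsotropic_fixed [TopologicalSpace W] (hK : ∀ u, K (K u) = u)
    (hb : ∀ u v, b (K u) (K v) = -b u v)
    (hnd : ∀ u, (∀ v, b u v = 0) → u = 0) (hL : ∀ u, u ∈ L ↔ K u = u)
    {B : W →L[ℝ] W →L[ℝ] ℝ} {s : ℝ} (hB : ∀ u v, B u v = s * b (K u) v) (hs : s ≠ 0) :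
    IsMaximalIsotropic B L := by
  constructor
  · intro u hu v hv
    rw [hB, (hL u).1 hu, eq_zero_of_mem_fixed hb hL hu hv, mul_zero]
  · intro L' hiso hle u hu
    rw [mem_fixed_iff hK hb hnd hL]
    intro v hv
    have h := hiso u hu v (hle hv)
    have h' := hb u v
    rw [(hL v).1 hv] at h'
    rw [hB, mul_eq_zero, or_iff_right hs, h'] at h
    linarith

/-- The antifixed space of `K` is the fixed space of the anti-symplectic involution `-K`. -/
theorem mem_antifixed_iff (hK : ∀ u, K (K u) = u) (hb : ∀ u v, b (K u) (K v) = -b u v)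
    (hnd : ∀ u, (∀ v, b u v = 0) → u = 0) (hL : ∀ u, u ∈ L ↔ K u = -u) (u : W) :
    u ∈ L ↔ ∀ v ∈ L, b u v = 0 :=
  mem_fixed_iff (K := -K) (by simpa using hK) (by simpa using hb) hnd
    (fun u => (hL u).trans neg_eq_iff_eq_neg.symm) u

theorem isMaximalIsotropic_antifixed [TopologicalSpace W] (hK : ∀ u, K (K u) = u)
    (hb : ∀ u v, b (K u) (K v) = -b u v)
    (hnd : ∀ u, (∀ v, b u v = 0) → u = 0) (hL : ∀ u, u ∈ L ↔ K u = -u)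
    {B : W →L[ℝ] W →L[ℝ] ℝ} (hB : ∀ u v, B u v = b (K u) v) :
    IsMaximalIsotropic B L :=
  isMaximalIsotropic_fixed (K := -K) (s := -1) (by simpa using hK) (by simpa using hb) hnd
    (fun u => (hL u).trans neg_eq_iff_eq_neg.symm) (by simpa using hB) (neg_ne_zero.2 one_ne_zero)

end Involution

section Signature

variable {V : Type*} [NormedAddCommGroup V] [NormedSpace ℝ V]
  {HN : Type*} [TopologicalSpace HN] (J : ModelWithCorners ℝ V HN)
  {N : Type*} [TopologicalSpace N] [ChartedSpace HN N]

/-- A bilinear form with an anti-isometric involution is neutral, since that involution exchanges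
the positive and the negative definite subspaces. -/
theorem sigPos_quadOf_eq_sigNeg {p : N} (B : TangentSpace J p →L[ℝ] TangentSpace J p →L[ℝ] ℝ)
    (K : TangentSpace J p →L[ℝ] TangentSpace J p) (hK : ∀ u, K (K u) = u)
    (hB : ∀ u v, B (K u) (K v) = -B u v) :
    sigPos (quadOf J B) = sigNeg (quadOf J B) := by
  have h : QuadraticMap.Equivalent (quadOf J B) (-quadOf J B) :=
    ⟨{ LinearEquiv.ofInvolutive (K : TangentSpace J p →ₗ[ℝ] TangentSpace J p) hK with
        map_app' := fun u => by
          change -B (K u) (K u) = B u u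
          rw [hB, neg_neg] }⟩
  exact h.sigPos_eq

end Signature

/-! ### Christoffel symbols -/

section Christoffel

variable {E : Type*} [NormedAddCommGroup E] [NormedSpace ℝ E] [FiniteDimensional ℝ E]
  {M : Type*} [TopologicalSpace M] [ChartedSpace E M] [IsManifold 𝓘(ℝ, E) ∞ M]
  (cov : CovariantDerivative 𝓘(ℝ, E) E (TangentSpace 𝓘(ℝ, E) : M → Type _))

/-- The coordinate vector field `r ↦ chartDSymm p r w` covariantly differentiated at `q`, read in
the chart around `p`. -/
noncomputable def covCoordinateField (p : M) (w : E) (q : M) : E →L[ℝ] E :=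
  chartD 𝓘(ℝ, E) p q ∘L cov (fun r => chartDSymm 𝓘(ℝ, E) p r w) q ∘L chartDSymm 𝓘(ℝ, E) p q

/-- The Christoffel symbols of `cov` in the chart around `p`: the bilinear map `Γ_y(v, w)` with
`∇_v Y = DY(v) + Γ(v, Y)` in that chart. They are defined through a basis of `E`, so that
bilinearity holds at every `y`, inside or outside of the chart. -/
noncomputable def christoffel (p : M) (y : E) : E →L[ℝ] E →L[ℝ] E :=
  (∑ i, ((Module.finBasis ℝ E).coord i).toContinuousLinearMap.smulRight
    (covCoordinateField cov p (Module.finBasis ℝ E i) ((extChartAt 𝓘(ℝ, E) p).symm y))).flip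

theorem christoffel_apply (p : M) (y v w : E) :
    christoffel cov p y v w = ∑ i, (Module.finBasis ℝ E).repr w i •
      covCoordinateField cov p (Module.finBasis ℝ E i) ((extChartAt 𝓘(ℝ, E) p).symm y) v := by
  simp [christoffel]

variable {cov}

omit [FiniteDimensional ℝ E] in
/-- The difference between `∇_u Y` and the directional derivative of `Y` in a chart is tensorial
in `Y`. -/
theorem tensorialAt_cov_sub_fderiv {p q : M} (hq : q ∈ (chartAt E p).source)
    (u : TangentSpace 𝓘(ℝ, E) q) :
    TensorialAt 𝓘(ℝ, E) E (fun Y : ∀ r : M, TangentSpace 𝓘(ℝ, E) r =>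
      chartD 𝓘(ℝ, E) p q (cov Y q u) - fderiv ℝ (fieldInChart Y p) (extChartAt 𝓘(ℝ, E) p q)
        (chartD 𝓘(ℝ, E) p q u)) q := by
  constructor
  · intro f Y hf hY
    have h3 : mvfderiv 𝓘(ℝ, E) f q u = fderiv ℝ (f ∘ (extChartAt 𝓘(ℝ, E) p).symm)
      (extChartAt 𝓘(ℝ, E) p q) (chartD 𝓘(ℝ, E) p q u) := mfderiv_apply_eq_fderiv hq hf u
    have hl : (extChartAt 𝓘(ℝ, E) p).symm (extChartAt 𝓘(ℝ, E) p q) = q :=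
      (extChartAt 𝓘(ℝ, E) p).left_inv (by rwa [extChartAt_source])
    rw [cov.isCovariantDerivativeOnUniv.leibniz hY hf, fieldInChart_smul,
      fderiv_fun_smul (differentiableAt_comp_symm hq hf) (differentiableAt_fieldInChart hq hY),
      fieldInChart_extChartAt Y hq, Function.comp_apply, hl]
    simp only [_root_.add_apply, _root_.smul_apply,
      ContinuousLinearMap.smulRight_apply, h3, map_add, map_smul, smul_sub]
    abel
  · intro Y Y' hY hY'
    rw [cov.isCovariantDerivativeOnUniv.add hY hY', fieldInChart_add,
      fderiv_fun_add (differentiableAt_fieldInChart hq hY) (differentiableAt_fieldInChart hq hY')]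
    simp only [_root_.add_apply, map_add]
    abel

omit [FiniteDimensional ℝ E] in
theorem mdifferentiableAt_chartDSymm {p q : M} (hq : q ∈ (chartAt E p).source) (w : E) :
    MDifferentiableAt 𝓘(ℝ, E) 𝓘(ℝ, E).tangent
      (fun r => (⟨r, chartDSymm 𝓘(ℝ, E) p r w⟩ : TangentBundle 𝓘(ℝ, E) M)) q :=
  (contMDiffAt_chartDSymm hq w).mdifferentiableAt (by simp)

omit [FiniteDimensional ℝ E] in
/-- A field that agrees with a coordinate field near `q` is constant near `q` in the chart. -/
theorem fieldInChart_eventuallyEq_const {X : ∀ r : M, TangentSpace 𝓘(ℝ, E) r} {p q : M}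
    (hq : q ∈ (chartAt E p).source) {w : E}
    (hX : ∀ᶠ r in 𝓝 q, X r = chartDSymm 𝓘(ℝ, E) p r w) :
    fieldInChart X p =ᶠ[𝓝 (extChartAt 𝓘(ℝ, E) p q)] fun _ => w := by
  have hq' : q ∈ (extChartAt 𝓘(ℝ, E) p).source := by rwa [extChartAt_source]
  have ht := (continuousAt_extChartAt_symm' hq').eventually
    (p := fun r => X r = chartDSymm 𝓘(ℝ, E) p r w)
    (by rwa [(extChartAt 𝓘(ℝ, E) p).left_inv hq'])
  filter_upwards [ht, (isOpen_extChartAt_target p).mem_nhds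
    ((extChartAt 𝓘(ℝ, E) p).map_source hq')] with y hy hyt
  rw [fieldInChart, hy, chartD_chartDSymm (symm_mem_source hyt)]

/-- The local formula `∇_u Y = DY(u) + Γ(u, Y)`. -/
theorem chartD_cov {p q : M} (hq : q ∈ (chartAt E p).source)
    {Y : ∀ r : M, TangentSpace 𝓘(ℝ, E) r}
    (hY : MDifferentiableAt 𝓘(ℝ, E) 𝓘(ℝ, E).tangent
      (fun r => (⟨r, Y r⟩ : TangentBundle 𝓘(ℝ, E) M)) q) (u : TangentSpace 𝓘(ℝ, E) q) :
    chartD 𝓘(ℝ, E) p q (cov Y q u)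
      = fderiv ℝ (fieldInChart Y p) (extChartAt 𝓘(ℝ, E) p q) (chartD 𝓘(ℝ, E) p q u)
        + christoffel cov p (extChartAt 𝓘(ℝ, E) p q) (chartD 𝓘(ℝ, E) p q u)
          (chartD 𝓘(ℝ, E) p q (Y q)) := by
  have hl : (extChartAt 𝓘(ℝ, E) p).symm (extChartAt 𝓘(ℝ, E) p q) = q :=
    (extChartAt 𝓘(ℝ, E) p).left_inv (by rwa [extChartAt_source])
  have hT := tensorialAt_cov_sub_fderiv (cov := cov) hq u
  set c : Fin _ → ℝ := fun i => (Module.finBasis ℝ E).repr (chartD 𝓘(ℝ, E) p q (Y q)) i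
  have hb : ∀ i, MDifferentiableAt 𝓘(ℝ, E) 𝓘(ℝ, E).tangent (fun r =>
      (⟨r, chartDSymm 𝓘(ℝ, E) p r (Module.finBasis ℝ E i)⟩ : TangentBundle 𝓘(ℝ, E) M)) q :=
    fun i => mdifferentiableAt_chartDSymm hq _
  have hcb : ∀ i, MDifferentiableAt 𝓘(ℝ, E) 𝓘(ℝ, E).tangent (fun r =>
      (⟨r, ((fun _ : M => c i) • fun r => chartDSymm 𝓘(ℝ, E) p r (Module.finBasis ℝ E i)) r⟩ :
        TangentBundle 𝓘(ℝ, E) M)) q :=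
    fun i => mdifferentiableAt_const.smul_section (hb i)
  have h1 := hT.pointwise (σ := Y) (σ' := fun r => ∑ i, ((fun _ : M => c i) •
    fun r => chartDSymm 𝓘(ℝ, E) p r (Module.finBasis ℝ E i)) r) hY
    (MDifferentiableAt.sum_section fun i _ => hcb i) (by
      apply chartD_injective hq
      simp only [Pi.smul_apply', map_sum, map_smul, chartD_chartDSymm hq]
      exact ((Module.finBasis ℝ E).sum_repr _).symm)
  rw [hT.sum _ fun i _ => hcb i] at h1
  simp only [hT.smul mdifferentiableAt_const (hb _)] at h1
  rw [sub_eq_iff_eq_add'] at h1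
  rw [h1, christoffel_apply, hl]
  congr 1
  refine Finset.sum_congr rfl fun i _ => ?_
  have hconst := fieldInChart_eventuallyEq_const hq
    (Filter.Eventually.of_forall fun r => rfl :
      ∀ᶠ r in 𝓝 q, (fun r => chartDSymm 𝓘(ℝ, E) p r (Module.finBasis ℝ E i)) r
        = chartDSymm 𝓘(ℝ, E) p r (Module.finBasis ℝ E i))
  rw [hconst.fderiv_eq, fderiv_const_apply, covCoordinateField]
  simp only [_root_.zero_apply, sub_zero, ContinuousLinearMap.comp_apply,
    chartDSymm_chartD hq, c]

omit [FiniteDimensional ℝ E] in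
theorem contMDiffAt_cov (hcov : CovariantDerivative.ContMDiffCovariantDerivative cov ∞)
    {X : ∀ r : M, TangentSpace 𝓘(ℝ, E) r} (hX : IsSmoothField 𝓘(ℝ, E) X) (q : M) :
    ContMDiffAt 𝓘(ℝ, E) (𝓘(ℝ, E).prod 𝓘(ℝ, E →L[ℝ] E)) ∞
      (fun r => TotalSpace.mk' (E →L[ℝ] E)
        (E := fun r : M => TangentSpace 𝓘(ℝ, E) r →L[ℝ] TangentSpace 𝓘(ℝ, E) r) r (cov X r)) q :=
  ((hcov.contMDiff.contMDiff (σ := X) (contMDiffOn_univ.2 hX)) q (mem_univ q)).contMDiffAt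
    Filter.univ_mem

theorem contDiffAt_christoffel [T2Space M]
    (hcov : CovariantDerivative.ContMDiffCovariantDerivative cov ∞) {p : M} {y : E}
    (hy : y ∈ (extChartAt 𝓘(ℝ, E) p).target) : ContDiffAt ℝ ∞ (christoffel cov p) y := by
  have hq := symm_mem_source hy
  have h : ∀ w : E, ContDiffAt ℝ ∞
      (fun y => covCoordinateField cov p w ((extChartAt 𝓘(ℝ, E) p).symm y)) y := by
    intro w
    refine contDiffAt_comp_symm (f := covCoordinateField cov p w) le_rfl hy ?_
    obtain ⟨X, hX, hXe⟩ := exists_isSmoothField_eventuallyEq_chartDSymm (J := 𝓘(ℝ, E)) hq w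
    refine ((contMDiffAt_endomorphism_iff hq).1 (contMDiffAt_cov hcov hX _)).congr_of_eventuallyEq
      ?_
    filter_upwards [hXe.eventually_nhds, (chartAt E p).open_source.mem_nhds hq] with r hr hrs
    rw [covCoordinateField, cov.isCovariantDerivativeOnUniv.congr_of_eventuallyEq
      (mdifferentiableAt_chartDSymm hrs w) (hX.contMDiffAt.mdifferentiableAt (by simp))
      Filter.univ_mem (hr.mono fun _ h => h.symm)]
  have hsum : ContDiffAt ℝ ∞ (fun y => ∑ i,
      ((Module.finBasis ℝ E).coord i).toContinuousLinearMap.smulRight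
      (covCoordinateField cov p (Module.finBasis ℝ E i) ((extChartAt 𝓘(ℝ, E) p).symm y))) y :=
    ContDiffAt.sum fun i _ => contDiffAt_const.smulRight (h _)
  exact (ContinuousLinearMap.flipₗᵢ ℝ E E E).contDiff.contDiffAt.comp y hsum

/-- The Christoffel symbols of a torsion-free connection are symmetric. -/
theorem christoffel_symm (ht : cov.torsion = 0) (p : M) (v w : E) :
    christoffel cov p (extChartAt 𝓘(ℝ, E) p p) v w
      = christoffel cov p (extChartAt 𝓘(ℝ, E) p p) w v := by
  have hp := mem_chart_source E p
  have hv := mdifferentiableAt_chartDSymm hp v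
  have hw := mdifferentiableAt_chartDSymm hp w
  have hc : ∀ u : E, fieldInChart (fun r => chartDSymm 𝓘(ℝ, E) p r u) p
      =ᶠ[𝓝 (extChartAt 𝓘(ℝ, E) p p)] fun _ => u :=
    fun u => fieldInChart_eventuallyEq_const hp (.of_forall fun _ => rfl)
  have h := congrArg (chartD 𝓘(ℝ, E) p p) (cov.torsion_eq_zero_iff.1 ht hv hw)
  rw [map_sub, chartD_cov hp hw, chartD_cov hp hv, (hc v).fderiv_eq, (hc w).fderiv_eq,
    chartD_chartDSymm hp, chartD_chartDSymm hp, mlieBracket_eq_lieBracket_fieldInChart,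
    (hc v).lieBracket_vectorField_eq (hc w)] at h
  simp only [fderiv_const_apply, _root_.zero_apply, zero_add, lieBracket_eq,
    sub_self] at h
  exact sub_eq_zero.1 (h.trans (map_zero _))

/-- Flatness in coordinates. -/
theorem christoffel_flat [T2Space M]
    (hcov : CovariantDerivative.ContMDiffCovariantDerivative cov ∞)
    (hflat : IsFlatConnection cov) (p : M) (v w u : E) :
    fderiv ℝ (christoffel cov p) (extChartAt 𝓘(ℝ, E) p p) v w u
        + christoffel cov p (extChartAt 𝓘(ℝ, E) p p) v
          (christoffel cov p (extChartAt 𝓘(ℝ, E) p p) w u)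
      = fderiv ℝ (christoffel cov p) (extChartAt 𝓘(ℝ, E) p p) w v u
        + christoffel cov p (extChartAt 𝓘(ℝ, E) p p) w
          (christoffel cov p (extChartAt 𝓘(ℝ, E) p p) v u) := by
  have hp := mem_chart_source E p
  obtain ⟨X, hX, hXe⟩ := exists_isSmoothField_eventuallyEq_chartDSymm (J := 𝓘(ℝ, E)) hp v
  obtain ⟨Y, hY, hYe⟩ := exists_isSmoothField_eventuallyEq_chartDSymm (J := 𝓘(ℝ, E)) hp w
  obtain ⟨Z, hZ, hZe⟩ := exists_isSmoothField_eventuallyEq_chartDSymm (J := 𝓘(ℝ, E)) hp u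
  have hΓ : DifferentiableAt ℝ (christoffel cov p) (extChartAt 𝓘(ℝ, E) p p) :=
    (contDiffAt_christoffel hcov (mem_extChartAt_target p)).differentiableAt (by simp)
  -- `∇_B Z` for a field `B` that is constant near `p` in the chart
  have key : ∀ (A B : ∀ r : M, TangentSpace 𝓘(ℝ, E) r) (a b : E),
      IsSmoothField 𝓘(ℝ, E) B →
      (∀ᶠ r in 𝓝 p, A r = chartDSymm 𝓘(ℝ, E) p r a) →
      (∀ᶠ r in 𝓝 p, B r = chartDSymm 𝓘(ℝ, E) p r b) →
      chartD 𝓘(ℝ, E) p p (cov (fun r => cov Z r (B r)) p (A p))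
        = fderiv ℝ (christoffel cov p) (extChartAt 𝓘(ℝ, E) p p) a b u
          + christoffel cov p (extChartAt 𝓘(ℝ, E) p p) a
            (christoffel cov p (extChartAt 𝓘(ℝ, E) p p) b u) := by
    intro A B a b hB hA' hB'
    have hcc : ∀ {C : ∀ r : M, TangentSpace 𝓘(ℝ, E) r} {c : E},
        (∀ᶠ r in 𝓝 p, C r = chartDSymm 𝓘(ℝ, E) p r c) →
        ∀ᶠ y in 𝓝 (extChartAt 𝓘(ℝ, E) p p), fieldInChart C p =ᶠ[𝓝 y] fun _ => c :=
      fun h => (fieldInChart_eventuallyEq_const hp h).eventuallyEq_nhds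
    have hmd : MDifferentiableAt 𝓘(ℝ, E) 𝓘(ℝ, E).tangent
        (fun r => (⟨r, cov Z r (B r)⟩ : TangentBundle 𝓘(ℝ, E) M)) p :=
      ((contMDiffAt_cov hcov hZ p).clm_bundle_apply hB.contMDiffAt).mdifferentiableAt (by simp)
    have hval : ∀ y ∈ (extChartAt 𝓘(ℝ, E) p).target, fieldInChart Z p =ᶠ[𝓝 y] (fun _ => u) →
        fieldInChart B p =ᶠ[𝓝 y] (fun _ => b) →
        fieldInChart (fun r => cov Z r (B r)) p y = christoffel cov p y b u := by
      intro y hy hZy hBy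
      have h := chartD_cov (cov := cov) (symm_mem_source hy)
        (hZ.contMDiffAt.mdifferentiableAt (by simp)) (B ((extChartAt 𝓘(ℝ, E) p).symm y))
      rw [(extChartAt 𝓘(ℝ, E) p).right_inv hy, hZy.fderiv_eq, fderiv_const_apply,
        _root_.zero_apply, zero_add] at h
      refine h.trans ?_
      exact congrArg₂ (fun c d => christoffel cov p y c d) hBy.self_of_nhds hZy.self_of_nhds
    have heq : fieldInChart (fun r => cov Z r (B r)) p
        =ᶠ[𝓝 (extChartAt 𝓘(ℝ, E) p p)] fun y => christoffel cov p y b u := by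
      filter_upwards [hcc hZe, hcc hB', (isOpen_extChartAt_target p).mem_nhds
        (mem_extChartAt_target p)] with y h1 h2 h3
      exact hval y h3 h1 h2
    have hAp : chartD 𝓘(ℝ, E) p p (A p) = a := by
      rw [hA'.self_of_nhds, chartD_chartDSymm hp]
    rw [chartD_cov hp hmd, ← fieldInChart_extChartAt (fun r => cov Z r (B r)) hp,
      heq.self_of_nhds, heq.fderiv_eq, hAp]
    congr 1
    exact fderiv_clm_apply_apply hΓ a b u
  have hbr : mlieBracket 𝓘(ℝ, E) X Y p = 0 := by
    rw [mlieBracket_eq_lieBracket_fieldInChart, (fieldInChart_eventuallyEq_const hp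
      hXe).lieBracket_vectorField_eq (fieldInChart_eventuallyEq_const hp hYe)]
    simp only [fderiv_const_apply, _root_.zero_apply, lieBracket_eq, sub_self]
    rfl
  have h := congrArg (chartD 𝓘(ℝ, E) p p) (hflat X Y Z hX hY hZ p)
  rw [hbr, map_zero, sub_zero, map_sub, key X Y v w hY hXe hYe, key Y X w v hX hYe hXe,
    map_zero, sub_eq_zero] at h
  exact h

end Christoffel

/-! ### Charts of the cotangent bundle -/

section CotangentCharts

variable {E : Type*} [NormedAddCommGroup E] [NormedSpace ℝ E]
  {M : Type*} [TopologicalSpace M] [ChartedSpace E M] [IsManifold 𝓘(ℝ, E) ∞ M]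

theorem trivializationAt_cotangent_apply (p : M) (β : CotangentBundle E M) :
    trivializationAt (E →L[ℝ] ℝ) (fun x : M => TangentSpace 𝓘(ℝ, E) x →L[ℝ] ℝ) p β
      = (β.proj, β.snd ∘L chartDSymm 𝓘(ℝ, E) p β.proj) := by
  refine Prod.ext rfl ?_
  ext v
  change (trivializationAt ℝ (Bundle.Trivial M ℝ) p).linearMapAt ℝ β.proj
    (β.snd (chartDSymm 𝓘(ℝ, E) p β.proj v)) = _
  rw [Trivialization.coe_linearMapAt_of_mem _ (mem_univ _)]
  rfl

theorem mem_cotangent_chart_source {α β : CotangentBundle E M} :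
    β ∈ (chartAt (ModelProd E (E →L[ℝ] ℝ)) α).source ↔ β.proj ∈ (chartAt E α.proj).source := by
  rw [FiberBundle.chartedSpace_chartAt]
  constructor
  · exact fun h => h.1.1
  · exact fun h => ⟨⟨h, mem_univ _⟩, h, mem_univ _⟩

/-- Coordinates of a covector: those of its base point, and its coefficients in the coordinate
coframe. -/
theorem extChartAt_cotangent (α β : CotangentBundle E M) :
    extChartAt (cotangentModel E) α β
      = (extChartAt 𝓘(ℝ, E) α.proj β.proj, β.snd ∘L chartDSymm 𝓘(ℝ, E) α.proj β.proj) := by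
  rw [FiberBundle.extChartAt]
  exact congrArg (fun z : M × (E →L[ℝ] ℝ) => (extChartAt 𝓘(ℝ, E) α.proj z.1, z.2))
    (trivializationAt_cotangent_apply α.proj β)

/-- In coordinates `dν` is the projection to the base. -/
theorem chartD_dProj {α β : CotangentBundle E M}
    (hβ : β ∈ (chartAt (ModelProd E (E →L[ℝ] ℝ)) α).source)
    (w : TangentSpace (cotangentModel E) β) :
    chartD 𝓘(ℝ, E) α.proj β.proj (dProj β w) = (chartD (cotangentModel E) α β w).1 := by
  have hp := mem_cotangent_chart_source.1 hβ
  have h1 : HasMFDerivAt (cotangentModel E) 𝓘(ℝ, E)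
      (extChartAt 𝓘(ℝ, E) α.proj ∘ fun β : CotangentBundle E M => β.proj) β
      ((mfderiv 𝓘(ℝ, E) 𝓘(ℝ, E) (extChartAt 𝓘(ℝ, E) α.proj) β.proj).comp (dProj β)) :=
    (mdifferentiableAt_extChartAt hp).hasMFDerivAt.comp β
      ((Bundle.contMDiffAt_proj _ (n := 1)).mdifferentiableAt one_ne_zero).hasMFDerivAt
  have h2 : HasMFDerivAt (cotangentModel E) 𝓘(ℝ, E)
      (ContinuousLinearMap.fst ℝ E (E →L[ℝ] ℝ) ∘ extChartAt (cotangentModel E) α) β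
      ((ContinuousLinearMap.fst ℝ E (E →L[ℝ] ℝ)).comp
        (mfderiv (cotangentModel E) 𝓘(ℝ, E × (E →L[ℝ] ℝ)) (extChartAt (cotangentModel E) α) β)) :=
    (ContinuousLinearMap.fst ℝ E (E →L[ℝ] ℝ)).hasMFDerivAt.comp β
      (mdifferentiableAt_extChartAt hβ).hasMFDerivAt
  have h3 : (extChartAt 𝓘(ℝ, E) α.proj ∘ fun β : CotangentBundle E M => β.proj)
      = ContinuousLinearMap.fst ℝ E (E →L[ℝ] ℝ) ∘ extChartAt (cotangentModel E) α := by
    ext γ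
    exact (congrArg Prod.fst (extChartAt_cotangent α γ)).symm
  rw [h3] at h1
  have h4 := hasMFDerivAt_unique h1 h2
  rw [chartD_eq_mfderiv hp, chartD_eq_mfderiv hβ]
  exact congrArg (fun L : (E × (E →L[ℝ] ℝ)) →L[ℝ] E => L w) h4

theorem mem_verticalSpace_iff {α β : CotangentBundle E M}
    (hβ : β ∈ (chartAt (ModelProd E (E →L[ℝ] ℝ)) α).source)
    (w : TangentSpace (cotangentModel E) β) :
    w ∈ verticalSpace β ↔ (chartD (cotangentModel E) α β w).1 = 0 := by
  rw [← chartD_dProj hβ, verticalSpace]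
  refine LinearMap.mem_ker.trans ⟨fun h => ?_, fun h => ?_⟩
  · exact (congrArg _ h).trans (map_zero _)
  · exact chartD_injective (mem_cotangent_chart_source.1 hβ) (h.trans (map_zero _).symm)

/-- The tautological form is `p dx` in every cotangent chart. -/
theorem tautologicalForm_eq {α β : CotangentBundle E M}
    (hβ : β ∈ (chartAt (ModelProd E (E →L[ℝ] ℝ)) α).source) :
    tautologicalForm E M β = (modelTautological
      (extChartAt (cotangentModel E) α β)).compContinuousLinearMap
        (chartD (cotangentModel E) α β) := by
  ext m
  rw [extChartAt_cotangent, ContinuousAlternatingMap.compContinuousLinearMap_apply,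
    modelTautological_apply]
  change β.snd (dProj β (m 0)) = β.snd (chartDSymm 𝓘(ℝ, E) α.proj β.proj
    (chartD (cotangentModel E) α β (m 0)).1)
  rw [← chartD_dProj hβ, chartDSymm_chartD (mem_cotangent_chart_source.1 hβ)]

/-- The canonical symplectic form is the standard one in every cotangent chart. -/
theorem canonicalForm_apply {α β : CotangentBundle E M}
    (hβ : β ∈ (chartAt (ModelProd E (E →L[ℝ] ℝ)) α).source)
    (m : Fin 2 → TangentSpace (cotangentModel E) β) :
    canonicalForm E M β m = modelSymplectic (chartD (cotangentModel E) α β (m 0))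
      (chartD (cotangentModel E) α β (m 1)) := by
  have h := mExtDeriv_eq_of_formInChart_eqOn (η := tautologicalForm E M) hβ
    (τ := modelTautological) (differentiable_modelTautological _)
    (fun r hr => tautologicalForm_eq hr)
  have h2 := congrArg (fun L : TangentSpace (cotangentModel E) β [⋀^Fin 2]→L[ℝ] ℝ => -(L m)) h
  refine h2.trans ?_
  rw [ContinuousAlternatingMap.compContinuousLinearMap_apply, extDeriv_modelTautological, neg_neg]
  rfl

end CotangentCharts

/-! ### Parallel covectors and the horizontal distribution -/

section Horizontal

variable {E : Type*} [NormedAddCommGroup E] [NormedSpace ℝ E]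
  {M : Type*} [TopologicalSpace M] [ChartedSpace E M] [IsManifold 𝓘(ℝ, E) ∞ M]

/-- The pairing of a covector with a vector, computed in coordinates. -/
theorem covector_apply {α β : CotangentBundle E M}
    (hβ : β ∈ (chartAt (ModelProd E (E →L[ℝ] ℝ)) α).source) (u : TangentSpace 𝓘(ℝ, E) β.proj) :
    β.snd u = (extChartAt (cotangentModel E) α β).2 (chartD 𝓘(ℝ, E) α.proj β.proj u) := by
  rw [extChartAt_cotangent, ContinuousLinearMap.comp_apply,
    chartDSymm_chartD (mem_cotangent_chart_source.1 hβ)]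

variable [FiniteDimensional ℝ E]
  {cov : CovariantDerivative 𝓘(ℝ, E) E (TangentSpace 𝓘(ℝ, E) : M → Type _)}

/-- The equation of parallel transport of covectors in coordinates, tested against one vector
field: `p' = p ∘ Γ(x', ·)`. -/
theorem hasDerivAt_covector_apply_iff {α : CotangentBundle E M} {c : ℝ → CotangentBundle E M}
    {t : ℝ} (hq : c t ∈ (chartAt (ModelProd E (E →L[ℝ] ℝ)) α).source)
    (hc : MDifferentiableAt 𝓘(ℝ, ℝ) (cotangentModel E) c t)
    {Y : ∀ x : M, TangentSpace 𝓘(ℝ, E) x} (hY : IsSmoothField 𝓘(ℝ, E) Y) {d : E × (E →L[ℝ] ℝ)}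
    (hd : chartD (cotangentModel E) α (c t)
      (mfderiv 𝓘(ℝ, ℝ) (cotangentModel E) c t (1 : ℝ)) = d) :
    HasDerivAt (fun s => (c s).snd (Y (c s).proj)) ((c t).snd (cov Y (c t).proj
        (mfderiv 𝓘(ℝ, ℝ) 𝓘(ℝ, E) (fun s => (c s).proj) t (1 : ℝ)))) t ↔
      d.2 (chartD 𝓘(ℝ, E) α.proj (c t).proj (Y (c t).proj))
        = horizontalLift (christoffel cov α.proj) (extChartAt (cotangentModel E) α (c t)) d.1
          (chartD 𝓘(ℝ, E) α.proj (c t).proj (Y (c t).proj)) := by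
  have hp := mem_cotangent_chart_source.1 hq
  have hYd : MDifferentiableAt 𝓘(ℝ, E) 𝓘(ℝ, E).tangent
      (fun r => (⟨r, Y r⟩ : TangentBundle 𝓘(ℝ, E) M)) (c t).proj :=
    hY.contMDiffAt.mdifferentiableAt (by simp)
  have h1 := hasDerivAt_extChartAt_comp hq hc
  rw [hd] at h1
  have hx : (extChartAt (cotangentModel E) α (c t)).1 = extChartAt 𝓘(ℝ, E) α.proj (c t).proj :=
    congrArg Prod.fst (extChartAt_cotangent α (c t))
  have hF := (differentiableAt_fieldInChart (p := α.proj) hp hYd).hasFDerivAt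
  rw [← hx] at hF
  -- the pairing in coordinates
  have h2 : HasDerivAt (fun s => (extChartAt (cotangentModel E) α (c s)).2
      (fieldInChart Y α.proj (extChartAt (cotangentModel E) α (c s)).1))
      (d.2 (fieldInChart Y α.proj (extChartAt (cotangentModel E) α (c t)).1)
        + (extChartAt (cotangentModel E) α (c t)).2 (fderiv ℝ (fieldInChart Y α.proj)
            (extChartAt (cotangentModel E) α (c t)).1 d.1)) t := by
    have h1a : HasDerivAt (fun s => (extChartAt (cotangentModel E) α (c s)).1) d.1 t :=
      (ContinuousLinearMap.fst ℝ E (E →L[ℝ] ℝ)).hasFDerivAt.comp_hasDerivAt t h1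
    have h1b := (ContinuousLinearMap.snd ℝ E (E →L[ℝ] ℝ)).hasFDerivAt.comp_hasDerivAt t h1
    have h1c : HasDerivAt (fieldInChart Y α.proj ∘
        fun s => (extChartAt (cotangentModel E) α (c s)).1)
        (fderiv ℝ (fieldInChart Y α.proj) (extChartAt (cotangentModel E) α (c t)).1 d.1) t :=
      HasFDerivAt.comp_hasDerivAt t hF h1a
    exact h1b.clm_apply h1c
  have h3 : (fun s => (c s).snd (Y (c s).proj)) =ᶠ[𝓝 t] fun s =>
      (extChartAt (cotangentModel E) α (c s)).2
      (fieldInChart Y α.proj (extChartAt (cotangentModel E) α (c s)).1) := by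
    filter_upwards [hc.continuousAt ((chartAt (ModelProd E (E →L[ℝ] ℝ)) α).open_source.mem_nhds hq)]
      with s hs
    rw [covector_apply hs, show (extChartAt (cotangentModel E) α (c s)).1 = _ from
      congrArg Prod.fst (extChartAt_cotangent α (c s)),
      fieldInChart_extChartAt _ (mem_cotangent_chart_source.1 hs)]
  have hu : chartD 𝓘(ℝ, E) α.proj (c t).proj
      (mfderiv 𝓘(ℝ, ℝ) 𝓘(ℝ, E) (fun s => (c s).proj) t (1 : ℝ)) = d.1 := by
    rw [← hd, ← chartD_dProj hq]
    refine congrArg _ ?_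
    have := mfderiv_comp t (g := fun β : CotangentBundle E M => β.proj)
      ((Bundle.contMDiffAt_proj _ (n := 1)).mdifferentiableAt one_ne_zero) hc
    exact congrArg (fun L : ℝ →L[ℝ] E => L 1) this
  rw [covector_apply hq, chartD_cov hp hYd, hu, map_add, ← fieldInChart_extChartAt Y hp, ← hx]
  rw [horizontalLift_apply, ContinuousLinearMap.comp_apply]
  constructor
  · intro h
    have := (h.congr_of_eventuallyEq h3.symm).unique h2
    linarith
  · intro h
    refine (h2.congr_of_eventuallyEq h3).congr_deriv ?_
    rw [h, add_comm]

theorem contDiffAt_christoffel_extChartAt_fst [T2Space M]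
    (hcov : CovariantDerivative.ContMDiffCovariantDerivative cov ∞) {α β : CotangentBundle E M}
    (hβ : β ∈ (chartAt (ModelProd E (E →L[ℝ] ℝ)) α).source) :
    ContDiffAt ℝ ∞ (christoffel cov α.proj) (extChartAt (cotangentModel E) α β).1 := by
  apply contDiffAt_christoffel hcov
  rw [extChartAt_cotangent]
  apply (extChartAt 𝓘(ℝ, E) α.proj).map_source
  rw [extChartAt_source]
  exact mem_cotangent_chart_source.1 hβ

/-- In coordinates, the velocities of parallel curves through `β = (x, p)` are the vectors
`(v, p ∘ Γ_x(v, ·))`. -/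
theorem mem_horizontalVelocities_iff [T2Space M]
    (hcov : CovariantDerivative.ContMDiffCovariantDerivative cov ∞) {α β : CotangentBundle E M}
    (hβ : β ∈ (chartAt (ModelProd E (E →L[ℝ] ℝ)) α).source)
    (w : TangentSpace (cotangentModel E) β) :
    w ∈ horizontalVelocities cov β ↔ (chartD (cotangentModel E) α β w).2
      = horizontalLift (christoffel cov α.proj) (extChartAt (cotangentModel E) α β)
        (chartD (cotangentModel E) α β w).1 := by
  constructor
  · rintro ⟨ε, hε, c, hc, htan⟩
    have hmem : (0 : ℝ) ∈ Ioo (-ε) ε := ⟨by linarith, hε⟩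
    have h0 : c 0 = β := congrArg TotalSpace.proj htan
    subst h0
    have hw : mfderiv 𝓘(ℝ, ℝ) (cotangentModel E) c 0 (1 : ℝ) = w :=
      eq_of_heq (TotalSpace.mk.inj htan).2
    have hcd : MDifferentiableAt 𝓘(ℝ, ℝ) (cotangentModel E) c 0 :=
      (hc.smooth.contMDiffAt (isOpen_Ioo.mem_nhds hmem)).mdifferentiableAt (by simp)
    have hp := mem_cotangent_chart_source.1 hβ
    ext v
    -- test parallelism against a global field with value `v` at the base point
    obtain ⟨Y, hY, hYe⟩ := exists_isSmoothField_eventuallyEq_chartDSymm (J := 𝓘(ℝ, E)) hp v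
    have h := (hasDerivAt_covector_apply_iff hβ hcd hY (congrArg _ hw)).1
      (hc.parallel 0 hmem Y hY)
    rwa [hYe.self_of_nhds, chartD_chartDSymm hp] at h
  · intro h
    set d := chartD (cotangentModel E) α β w with hd
    have hβ' : β ∈ (extChartAt (cotangentModel E) α).source := by rwa [extChartAt_source]
    have hΓ : ∀ z ∈ (extChartAt (cotangentModel E) α).target,
        ContDiffAt ℝ ∞ (christoffel cov α.proj) z.1 := fun z hz => by
      rw [← (extChartAt (cotangentModel E) α).right_inv hz]
      exact contDiffAt_christoffel_extChartAt_fst hcov (symm_mem_source hz)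
    -- the parallel curves are the integral curves of a vector field in the chart
    have hF : ContDiffOn ℝ ∞ (fun z : E × (E →L[ℝ] ℝ) =>
        (d.1, horizontalLift (christoffel cov α.proj) z d.1))
        (extChartAt (cotangentModel E) α).target := fun z hz =>
      (contDiffAt_const.prodMk
        ((ContDiffAt.horizontalLift (hΓ z hz)).clm_apply contDiffAt_const)).contDiffWithinAt
    obtain ⟨ε, hε, γ, hγ0, hγU, hγs, hγ⟩ := exists_contDiffOn_integralCurve
      (isOpen_extChartAt_target α) hF ((extChartAt (cotangentModel E) α).map_source hβ')
    have hmem : (0 : ℝ) ∈ Ioo (-ε) ε := ⟨by linarith, hε⟩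
    set c : ℝ → CotangentBundle E M := fun t => (extChartAt (cotangentModel E) α).symm (γ t)
    have hcs : ContMDiffOn 𝓘(ℝ, ℝ) (cotangentModel E) ∞ c (Ioo (-ε) ε) :=
      (contMDiffOn_extChartAt_symm α).comp hγs.contMDiffOn hγU
    have hq : ∀ t ∈ Ioo (-ε) ε, c t ∈ (chartAt (ModelProd E (E →L[ℝ] ℝ)) α).source :=
      fun t ht => symm_mem_source (hγU ht)
    have hext : ∀ t ∈ Ioo (-ε) ε, extChartAt (cotangentModel E) α (c t) = γ t :=
      fun t ht => (extChartAt (cotangentModel E) α).right_inv (hγU ht)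
    have hcd : ∀ t ∈ Ioo (-ε) ε, MDifferentiableAt 𝓘(ℝ, ℝ) (cotangentModel E) c t :=
      fun t ht => (hcs.contMDiffAt (isOpen_Ioo.mem_nhds ht)).mdifferentiableAt (by simp)
    have hvel : ∀ t ∈ Ioo (-ε) ε, chartD (cotangentModel E) α (c t)
        (mfderiv 𝓘(ℝ, ℝ) (cotangentModel E) c t (1 : ℝ))
          = (d.1, horizontalLift (christoffel cov α.proj) (γ t) d.1) := by
      intro t ht
      refine (hasDerivAt_extChartAt_comp (hq t ht) (hcd t ht)).unique
        ((hγ t ht).congr_of_eventuallyEq ?_)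
      filter_upwards [isOpen_Ioo.mem_nhds ht] with s hs using hext s hs
    have hc0 : c 0 = β := by
      simp only [c, hγ0]
      exact (extChartAt (cotangentModel E) α).left_inv hβ'
    refine ⟨ε, hε, c, ⟨hcs, fun t ht Y hY => ?_⟩, ?_⟩
    · rw [hasDerivAt_covector_apply_iff (hq t ht) (hcd t ht) hY (hvel t ht), hext t ht]
    · refine (tangentBundle_eq_iff (hq 0 hmem) hβ).2 ⟨hc0, (hvel 0 hmem).trans ?_⟩
      rw [hγ0, ← h]

/-- The horizontal velocities already form a linear subspace. -/
theorem coe_horizontalSpace [T2Space M]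
    (hcov : CovariantDerivative.ContMDiffCovariantDerivative cov ∞) (β : CotangentBundle E M) :
    (horizontalSpace cov β : Set (TangentSpace (cotangentModel E) β))
      = horizontalVelocities cov β := by
  have hβ := mem_chart_source (ModelProd E (E →L[ℝ] ℝ)) β
  -- in the chart around `β` the condition is linear
  have h : horizontalVelocities cov β = (LinearMap.ker (((ContinuousLinearMap.snd ℝ E (E →L[ℝ] ℝ)
      - (horizontalLift (christoffel cov β.proj) (extChartAt (cotangentModel E) β β)).comp
        (ContinuousLinearMap.fst ℝ E (E →L[ℝ] ℝ))).comp
          (chartD (cotangentModel E) β β)).toLinearMap) :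
      Submodule ℝ (TangentSpace (cotangentModel E) β)) := by
    ext w
    exact (mem_horizontalVelocities_iff hcov hβ w).trans sub_eq_zero.symm
  rw [horizontalSpace, h, Submodule.span_eq]

theorem mem_horizontalSpace_iff [T2Space M]
    (hcov : CovariantDerivative.ContMDiffCovariantDerivative cov ∞) {α β : CotangentBundle E M}
    (hβ : β ∈ (chartAt (ModelProd E (E →L[ℝ] ℝ)) α).source)
    (w : TangentSpace (cotangentModel E) β) :
    w ∈ horizontalSpace cov β ↔ (chartD (cotangentModel E) α β w).2
      = horizontalLift (christoffel cov α.proj) (extChartAt (cotangentModel E) α β)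
        (chartD (cotangentModel E) α β w).1 := by
  rw [← mem_horizontalVelocities_iff hcov hβ, ← coe_horizontalSpace hcov]
  rfl

end Horizontal

/-! ### The involution, the metric and the canonical form -/

section Cotangent

variable {E : Type*} [NormedAddCommGroup E] [NormedSpace ℝ E] [FiniteDimensional ℝ E]
  {M : Type*} [TopologicalSpace M] [ChartedSpace E M] [IsManifold 𝓘(ℝ, E) ∞ M]
  (cov : CovariantDerivative 𝓘(ℝ, E) E (TangentSpace 𝓘(ℝ, E) : M → Type _))

/-- The endomorphism field of `T(T*M)` that is the identity on the horizontal and minus the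
identity on the vertical distribution, defined at `β` in the chart around `β`. -/
noncomputable def splittingInvolution (β : CotangentBundle E M) :
    TangentSpace (cotangentModel E) β →L[ℝ] TangentSpace (cotangentModel E) β :=
  chartDSymm (cotangentModel E) β β ∘L
    modelParacomplex (christoffel cov β.proj) (extChartAt (cotangentModel E) β β) ∘L
      chartD (cotangentModel E) β β

/-- The bilinear form `(u, v) ↦ Ω(Ku, v)`, defined at `β` in the chart around `β`. -/
noncomputable def splittingMetric (β : CotangentBundle E M) :
    TangentSpace (cotangentModel E) β →L[ℝ] TangentSpace (cotangentModel E) β →L[ℝ] ℝ :=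
  (ContinuousLinearMap.precomp ℝ (chartD (cotangentModel E) β β)) ∘L modelSymplectic ∘L
    modelParacomplex (christoffel cov β.proj) (extChartAt (cotangentModel E) β β) ∘L
      chartD (cotangentModel E) β β

variable {cov}

theorem chartD_self_splittingInvolution (β : CotangentBundle E M)
    (u : TangentSpace (cotangentModel E) β) :
    chartD (cotangentModel E) β β (splittingInvolution cov β u)
      = modelParacomplex (christoffel cov β.proj) (extChartAt (cotangentModel E) β β)
        (chartD (cotangentModel E) β β u) :=
  chartD_chartDSymm (mem_chart_source _ β) _

theorem splittingInvolution_splittingInvolution (β : CotangentBundle E M)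
    (u : TangentSpace (cotangentModel E) β) :
    splittingInvolution cov β (splittingInvolution cov β u) = u := by
  apply chartD_injective (mem_chart_source (ModelProd E (E →L[ℝ] ℝ)) β)
  rw [chartD_self_splittingInvolution, chartD_self_splittingInvolution,
    modelParacomplex_modelParacomplex]

theorem mem_verticalSpace_iff_splittingInvolution {β : CotangentBundle E M}
    {u : TangentSpace (cotangentModel E) β} :
    u ∈ verticalSpace β ↔ splittingInvolution cov β u = -u := by
  have hβ := mem_chart_source (ModelProd E (E →L[ℝ] ℝ)) β
  rw [mem_verticalSpace_iff hβ, ← modelParacomplex_eq_neg_iff (christoffel cov β.proj)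
    (extChartAt (cotangentModel E) β β), ← chartD_self_splittingInvolution,
    ← ContinuousLinearMap.map_neg,
    (chartD_injective hβ).eq_iff]

theorem splittingMetric_apply (β : CotangentBundle E M) (u v : TangentSpace (cotangentModel E) β) :
    splittingMetric cov β u v = canonicalForm E M β ![splittingInvolution cov β u, v] := by
  rw [canonicalForm_apply (mem_chart_source _ β)]
  exact (congrArg (fun d => modelSymplectic d (chartD (cotangentModel E) β β v))
    (chartD_self_splittingInvolution β u)).symm

/-- The involution is anti-symplectic, because the connection is torsion-free. -/
theorem canonicalForm_splittingInvolution (ht : cov.torsion = 0) (β : CotangentBundle E M)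
    (u v : TangentSpace (cotangentModel E) β) :
    canonicalForm E M β ![splittingInvolution cov β u, splittingInvolution cov β v]
      = -canonicalForm E M β ![u, v] := by
  have hβ := mem_chart_source (ModelProd E (E →L[ℝ] ℝ)) β
  rw [canonicalForm_apply hβ, canonicalForm_apply hβ]
  refine Eq.trans ?_ (modelSymplectic_modelParacomplex (Γ := christoffel cov β.proj)
    (z := extChartAt (cotangentModel E) β β) ?_ _ _)
  · exact congrArg₂ (fun d d' => modelSymplectic d d') (chartD_self_splittingInvolution β u)
      (chartD_self_splittingInvolution β v)
  · rw [extChartAt_cotangent]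
    exact christoffel_symm ht β.proj

variable [T2Space M]

theorem mem_horizontalSpace_iff_splittingInvolution
    (hcov : CovariantDerivative.ContMDiffCovariantDerivative cov ∞) {β : CotangentBundle E M}
    {u : TangentSpace (cotangentModel E) β} :
    u ∈ horizontalSpace cov β ↔ splittingInvolution cov β u = u := by
  have hβ := mem_chart_source (ModelProd E (E →L[ℝ] ℝ)) β
  rw [mem_horizontalSpace_iff hcov hβ, ← modelParacomplex_eq_self_iff,
    ← chartD_self_splittingInvolution, (chartD_injective hβ).eq_iff]

/-- The involution has the same expression in every cotangent chart, because the splitting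
has. -/
theorem chartD_splittingInvolution
    (hcov : CovariantDerivative.ContMDiffCovariantDerivative cov ∞) {α β : CotangentBundle E M}
    (hβ : β ∈ (chartAt (ModelProd E (E →L[ℝ] ℝ)) α).source)
    (u : TangentSpace (cotangentModel E) β) :
    chartD (cotangentModel E) α β (splittingInvolution cov β u)
      = modelParacomplex (christoffel cov α.proj) (extChartAt (cotangentModel E) α β)
        (chartD (cotangentModel E) α β u) := by
  -- `h` and `v` are the horizontal and the vertical part of `u`, computed in the chart around `α`
  set d := chartD (cotangentModel E) α β u
  set l := horizontalLift (christoffel cov α.proj) (extChartAt (cotangentModel E) α β) d.1 with hl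
  set h := chartDSymm (cotangentModel E) α β (d.1, l)
  set v := chartDSymm (cotangentModel E) α β (0, d.2 - l)
  have hh : chartD (cotangentModel E) α β h = (d.1, l) := chartD_chartDSymm hβ _
  have hv : chartD (cotangentModel E) α β v = (0, d.2 - l) := chartD_chartDSymm hβ _
  have hu : u = h + v := by
    apply chartD_injective hβ
    refine Eq.trans ?_ (ContinuousLinearMap.map_add _ _ _).symm
    rw [hh, hv]
    exact Prod.ext (add_zero _).symm (add_sub_cancel _ _).symm
  have hKh : splittingInvolution cov β h = h := by
    rw [← mem_horizontalSpace_iff_splittingInvolution hcov, mem_horizontalSpace_iff hcov hβ, hh]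
  have hKv : splittingInvolution cov β v = -v := by
    rw [← mem_verticalSpace_iff_splittingInvolution, mem_verticalSpace_iff hβ, hv]
  have hKu : splittingInvolution cov β u = h - v := by
    rw [hu, ContinuousLinearMap.map_add, hKh, hKv, sub_eq_add_neg]
  rw [hKu]
  refine (ContinuousLinearMap.map_sub _ _ _).trans ?_
  rw [hh, hv, modelParacomplex_apply]
  refine Prod.ext (sub_zero _) ?_
  rw [two_smul]
  exact (sub_sub_eq_add_sub _ _ _).trans rfl

theorem contMDiffAt_modelParacomplex
    (hcov : CovariantDerivative.ContMDiffCovariantDerivative cov ∞) (α : CotangentBundle E M) :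
    ContMDiffAt (cotangentModel E) 𝓘(ℝ, (E × (E →L[ℝ] ℝ)) →L[ℝ] (E × (E →L[ℝ] ℝ))) ∞
      (fun β => modelParacomplex (christoffel cov α.proj) (extChartAt (cotangentModel E) α β)) α :=
  (ContDiffAt.modelParacomplex (contDiffAt_christoffel_extChartAt_fst hcov
    (mem_chart_source _ α))).contMDiffAt.comp α contMDiffAt_extChartAt

theorem contMDiff_splittingInvolution
    (hcov : CovariantDerivative.ContMDiffCovariantDerivative cov ∞) :
    ContMDiff (cotangentModel E) ((cotangentModel E).prod
        𝓘(ℝ, (E × (E →L[ℝ] ℝ)) →L[ℝ] (E × (E →L[ℝ] ℝ)))) ∞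
      (fun β : CotangentBundle E M => TotalSpace.mk' ((E × (E →L[ℝ] ℝ)) →L[ℝ] (E × (E →L[ℝ] ℝ)))
        (E := fun β : CotangentBundle E M => TangentSpace (cotangentModel E) β →L[ℝ]
          TangentSpace (cotangentModel E) β) β (splittingInvolution cov β)) := by
  intro α
  have hα := mem_chart_source (ModelProd E (E →L[ℝ] ℝ)) α
  refine (contMDiffAt_endomorphism_iff hα).2
    ((contMDiffAt_modelParacomplex hcov α).congr_of_eventuallyEq ?_)
  filter_upwards [(chartAt (ModelProd E (E →L[ℝ] ℝ)) α).open_source.mem_nhds hα] with β hβ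
  refine ContinuousLinearMap.ext fun d => ?_
  exact (chartD_splittingInvolution hcov hβ _).trans (congrArg _ (chartD_chartDSymm hβ d))

omit [FiniteDimensional ℝ E] [T2Space M] in
/-- The canonical form has constant coefficients in the cotangent charts, hence is closed. -/
theorem isSymplecticForm_canonicalForm :
    IsSymplecticForm (cotangentModel E) (canonicalForm E M) where
  smooth X Y hX hY := contMDiff_bilinear_apply_of_chart modelSymplectic hX hY
    fun p q hq => canonicalForm_apply hq _
  closed := mExtDeriv_eq_zero_of_const (-extDeriv modelTautological 0) fun p q hq => by
    ext m
    rw [canonicalForm_apply hq, ContinuousAlternatingMap.compContinuousLinearMap_apply,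
      ContinuousAlternatingMap.neg_apply, extDeriv_modelTautological, neg_neg]
    rfl
  nondegenerate p u h := by
    have hp := mem_chart_source (ModelProd E (E →L[ℝ] ℝ)) p
    apply chartD_injective hp
    refine (eq_zero_of_modelSymplectic_eq_zero fun v => ?_).trans
      (ContinuousLinearMap.map_zero _).symm
    have h1 := h (chartDSymm (cotangentModel E) p p v)
    rw [canonicalForm_apply hp] at h1
    exact (congrArg (modelSymplectic (chartD (cotangentModel E) p p u))
      (chartD_chartDSymm hp v)).symm.trans h1

theorem nijenhuis_splittingInvolution
    (hcov : CovariantDerivative.ContMDiffCovariantDerivative cov ∞) (hflat : IsFlatConnection cov)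
    {X Y : ∀ β : CotangentBundle E M, TangentSpace (cotangentModel E) β}
    (hX : IsSmoothField (cotangentModel E) X) (hY : IsSmoothField (cotangentModel E) Y)
    (p : CotangentBundle E M) :
    mlieBracket (cotangentModel E) X Y p
      + mlieBracket (cotangentModel E) (fun q => splittingInvolution cov q (X q))
          (fun q => splittingInvolution cov q (Y q)) p
      - splittingInvolution cov p
          (mlieBracket (cotangentModel E) (fun q => splittingInvolution cov q (X q)) Y p)
      - splittingInvolution cov p
          (mlieBracket (cotangentModel E) X (fun q => splittingInvolution cov q (Y q)) p) = 0 := by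
  have hp := mem_chart_source (ModelProd E (E →L[ℝ] ℝ)) p
  have hK : ∀ Z : ∀ β : CotangentBundle E M, TangentSpace (cotangentModel E) β,
      fieldInChart (fun q => splittingInvolution cov q (Z q)) p
        =ᶠ[𝓝 (extChartAt (cotangentModel E) p p)]
      fun y => modelParacomplex (christoffel cov p.proj) y (fieldInChart Z p y) := by
    intro Z
    filter_upwards [(isOpen_extChartAt_target p).mem_nhds (mem_extChartAt_target p)] with y hy
    refine (chartD_splittingInvolution hcov (symm_mem_source hy) _).trans ?_
    rw [(extChartAt (cotangentModel E) p).right_inv hy]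
    rfl
  -- at its centre `p` the differential of the chart is the identity
  have hself : ∀ w : E × (E →L[ℝ] ℝ), splittingInvolution cov p w = modelParacomplex
      (christoffel cov p.proj) (extChartAt (cotangentModel E) p p) w := by
    intro w
    have h := chartD_self_splittingInvolution (cov := cov) p w
    rw [chartD_self] at h
    exact h
  have hd : ∀ {Z : ∀ β : CotangentBundle E M, TangentSpace (cotangentModel E) β},
      IsSmoothField (cotangentModel E) Z →
      DifferentiableAt ℝ (fieldInChart Z p) (extChartAt (cotangentModel E) p p) :=
    fun hZ => differentiableAt_fieldInChart hp (hZ.contMDiffAt.mdifferentiableAt (by simp))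
  have hΓ := contDiffAt_christoffel_extChartAt_fst hcov hp
  have hN := nijenhuis_modelParacomplex_eq_zero hΓ (by
    rw [extChartAt_cotangent]
    exact christoffel_flat hcov hflat p.proj) (hd hX) (hd hY)
  rw [mlieBracket_eq_lieBracket_fieldInChart, mlieBracket_eq_lieBracket_fieldInChart,
    mlieBracket_eq_lieBracket_fieldInChart, mlieBracket_eq_lieBracket_fieldInChart,
    (hK X).lieBracket_vectorField_eq (hK Y), (hK X).lieBracket_vectorField_eq .rfl,
    Filter.EventuallyEq.lieBracket_vectorField_eq .rfl (hK Y)]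
  refine Eq.trans ?_ hN
  exact congrArg₂ (· - ·) (congrArg _ (hself _)) (hself _)

end Cotangent

/-! ### The para-Kähler structure -/

section ParaKahler

variable {E : Type*} [NormedAddCommGroup E] [NormedSpace ℝ E] [FiniteDimensional ℝ E]
  {M : Type*} [TopologicalSpace M] [ChartedSpace E M] [IsManifold 𝓘(ℝ, E) ∞ M]
  {cov : CovariantDerivative 𝓘(ℝ, E) E (TangentSpace 𝓘(ℝ, E) : M → Type _)}

omit [FiniteDimensional ℝ E] in
theorem canonicalForm_swap (β : CotangentBundle E M) (u v : TangentSpace (cotangentModel E) β) :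
    canonicalForm E M β ![u, v] = -canonicalForm E M β ![v, u] := by
  rw [canonicalForm_apply (mem_chart_source _ β), canonicalForm_apply (mem_chart_source _ β)]
  simp

variable [T2Space M]

theorem isParaComplex_splittingInvolution
    (hcov : CovariantDerivative.ContMDiffCovariantDerivative cov ∞) (ht : cov.torsion = 0)
    (hflat : IsFlatConnection cov) :
    IsParaComplex (cotangentModel E) (splittingInvolution cov) where
  smooth := contMDiff_splittingInvolution hcov
  sq_eq_id := splittingInvolution_splittingInvolution
  equal_rank p :=
    have : FiniteDimensional ℝ (TangentSpace (cotangentModel E) p) :=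
      inferInstanceAs (FiniteDimensional ℝ (E × (E →L[ℝ] ℝ)))
    finrank_fixed_eq (K := (splittingInvolution cov p).toLinearMap)
    (b := bilinOfTwoForm (canonicalForm E M p))
    (splittingInvolution_splittingInvolution p)
    (canonicalForm_splittingInvolution ht p)
    (isSymplecticForm_canonicalForm.nondegenerate p)
    (fun _ => mem_eigenPlus) (fun _ => mem_eigenMinus)
  nijenhuis _ _ hX hY p := nijenhuis_splittingInvolution hcov hflat hX hY p

omit [T2Space M] in
theorem splittingMetric_splittingInvolution (ht : cov.torsion = 0) (β : CotangentBundle E M)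
    (u v : TangentSpace (cotangentModel E) β) :
    splittingMetric cov β (splittingInvolution cov β u) (splittingInvolution cov β v)
      = -splittingMetric cov β u v := by
  rw [splittingMetric_apply, splittingMetric_apply, canonicalForm_splittingInvolution ht]

/-- Symmetry of the metric is antisymmetry of `Ω` together with `Ω(Ku, Kv) = -Ω(u, v)`. -/
theorem isNeutralMetric_splittingMetric
    (hcov : CovariantDerivative.ContMDiffCovariantDerivative cov ∞) (ht : cov.torsion = 0) :
    IsNeutralMetric (cotangentModel E) (splittingMetric cov) where
  smooth := contMDiff_bilinear_of_chart modelSymplectic (contMDiffAt_modelParacomplex hcov)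
    fun α β hβ u v => by
      rw [splittingMetric_apply, canonicalForm_apply hβ]
      exact congrArg (fun d => modelSymplectic d (chartD (cotangentModel E) α β v))
        (chartD_splittingInvolution hcov hβ u)
  symm β u v := by
    rw [splittingMetric_apply, splittingMetric_apply, canonicalForm_swap,
      ← canonicalForm_splittingInvolution ht, splittingInvolution_splittingInvolution]
  nondegenerate β u h := by
    have h0 : splittingInvolution cov β u = 0 :=
      isSymplecticForm_canonicalForm.nondegenerate β _ fun v =>
        (splittingMetric_apply β u v).symm.trans (h v)
    rw [← splittingInvolution_splittingInvolution (cov := cov) β u, h0,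
      ContinuousLinearMap.map_zero]
  neutral β := sigPos_quadOf_eq_sigNeg _ _ (splittingInvolution cov β)
    (splittingInvolution_splittingInvolution β) (splittingMetric_splittingInvolution ht β)

omit [T2Space M] in
theorem canonicalForm_eq_splittingMetric (β : CotangentBundle E M)
    (u v : TangentSpace (cotangentModel E) β) :
    canonicalForm E M β ![u, v] = splittingMetric cov β (splittingInvolution cov β u) v := by
  rw [splittingMetric_apply, splittingInvolution_splittingInvolution]

theorem isParaKahler_splitting
    (hcov : CovariantDerivative.ContMDiffCovariantDerivative cov ∞) (ht : cov.torsion = 0)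
    (hflat : IsFlatConnection cov) :
    IsParaKahler (cotangentModel E) (splittingMetric cov) (splittingInvolution cov)
      (canonicalForm E M) where
  neutralMetric := isNeutralMetric_splittingMetric hcov ht
  paraComplex := isParaComplex_splittingInvolution hcov ht hflat
  symplectic := isSymplecticForm_canonicalForm
  antiIsometry := splittingMetric_splittingInvolution ht
  compatible := canonicalForm_eq_splittingMetric

theorem isCompl_horizontalSpace_verticalSpace
    (hcov : CovariantDerivative.ContMDiffCovariantDerivative cov ∞) (β : CotangentBundle E M) :
    IsCompl (horizontalSpace cov β) (verticalSpace β) :=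
  isCompl_of_involution (K := (splittingInvolution cov β).toLinearMap)
    (splittingInvolution_splittingInvolution β)
    (fun _ => mem_horizontalSpace_iff_splittingInvolution hcov)
    (fun _ => mem_verticalSpace_iff_splittingInvolution)

theorem eigenPlus_splittingInvolution
    (hcov : CovariantDerivative.ContMDiffCovariantDerivative cov ∞) (β : CotangentBundle E M) :
    eigenPlus (cotangentModel E) (splittingInvolution cov) β = horizontalSpace cov β := by
  ext u
  rw [mem_eigenPlus, mem_horizontalSpace_iff_splittingInvolution hcov]

omit [T2Space M] in
theorem eigenMinus_splittingInvolution (β : CotangentBundle E M) :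
    eigenMinus (cotangentModel E) (splittingInvolution cov) β = verticalSpace β := by
  ext u
  rw [mem_eigenMinus, ← mem_verticalSpace_iff_splittingInvolution]

theorem isInducedBySplitting_splittingInvolution
    (hcov : CovariantDerivative.ContMDiffCovariantDerivative cov ∞) :
    IsInducedBySplitting cov (splittingInvolution cov) := fun _ =>
  ⟨fun _ hu => (mem_horizontalSpace_iff_splittingInvolution hcov).1 hu,
    fun _ hu => mem_verticalSpace_iff_splittingInvolution.1 hu⟩

theorem IsInducedBySplitting.eq
    (hcov : CovariantDerivative.ContMDiffCovariantDerivative cov ∞)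
    {K K' : ∀ α : CotangentBundle E M,
      TangentSpace (cotangentModel E) α →L[ℝ] TangentSpace (cotangentModel E) α}
    (hK : IsInducedBySplitting cov K) (hK' : IsInducedBySplitting cov K') : K = K' := by
  funext α
  refine ContinuousLinearMap.ext fun u => ?_
  obtain ⟨h, hh, v, hv, rfl⟩ := Submodule.mem_sup.1
    ((isCompl_horizontalSpace_verticalSpace hcov α).sup_eq_top ▸ Submodule.mem_top (x := u))
  rw [ContinuousLinearMap.map_add, ContinuousLinearMap.map_add, (hK α).1 h hh, (hK' α).1 h hh,
    (hK α).2 v hv, (hK' α).2 v hv]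

end ParaKahler

theorem proposition2
    {E : Type*} [NormedAddCommGroup E] [NormedSpace ℝ E] [FiniteDimensional ℝ E]
    {M : Type*} [TopologicalSpace M] [ChartedSpace E M] [IsManifold 𝓘(ℝ, E) ∞ M] [T2Space M]
    (g : ContMDiffRiemannianMetric 𝓘(ℝ, E) ∞ E (TangentSpace 𝓘(ℝ, E) : M → Type _))
    (cov : CovariantDerivative 𝓘(ℝ, E) E (TangentSpace 𝓘(ℝ, E) : M → Type _))
    (hM : IsHessianManifold g cov) :
    (∀ α : CotangentBundle E M,
      (horizontalSpace cov α : Set (TangentSpace (cotangentModel E) α))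
        = horizontalVelocities cov α ∧
      IsCompl (horizontalSpace cov α) (verticalSpace α)) ∧
    ∃ K : ∀ α : CotangentBundle E M,
        TangentSpace (cotangentModel E) α →L[ℝ] TangentSpace (cotangentModel E) α,
      IsInducedBySplitting cov K ∧
      (∀ K', IsInducedBySplitting cov K' → K' = K) ∧
      ∃ G : ∀ α : CotangentBundle E M,
          TangentSpace (cotangentModel E) α →L[ℝ] TangentSpace (cotangentModel E) α →L[ℝ] ℝ,
        IsParaKahler (cotangentModel E) G K (canonicalForm E M) ∧
        (∀ G', IsNeutralMetric (cotangentModel E) G' →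
          (∀ (α : CotangentBundle E M) (u v : TangentSpace (cotangentModel E) α),
            canonicalForm E M α ![u, v] = G' α (K α u) v) → G' = G) ∧
        (∀ α : CotangentBundle E M,
          eigenPlus (cotangentModel E) K α = horizontalSpace cov α ∧
          eigenMinus (cotangentModel E) K α = verticalSpace α ∧
          IsMaximalIsotropic (G α) (eigenPlus (cotangentModel E) K α) ∧
          IsMaximalIsotropic (G α) (eigenMinus (cotangentModel E) K α) ∧
          IsLagrangianSubspace (canonicalForm E M α) (eigenPlus (cotangentModel E) K α) ∧
          IsLagrangianSubspace (canonicalForm E M α) (eigenMinus (cotangentModel E) K α) ∧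
          IsCompl (eigenPlus (cotangentModel E) K α) (eigenMinus (cotangentModel E) K α)) ∧
        IsInvolutive (cotangentModel E) (eigenPlus (cotangentModel E) K) ∧
        IsInvolutive (cotangentModel E) (eigenMinus (cotangentModel E) K) := by
  have hcov := hM.smooth
  have ht := hM.torsionFree
  have hP := isParaKahler_splitting hcov ht hM.flat
  have hsq := splittingInvolution_splittingInvolution (cov := cov)
  have hanti := canonicalForm_splittingInvolution (E := E) (M := M) ht
  have hnd := hP.symplectic.nondegenerate
  refine ⟨fun α => ⟨coe_horizontalSpace hcov α, isCompl_horizontalSpace_verticalSpace hcov α⟩,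
    splittingInvolution cov, isInducedBySplitting_splittingInvolution hcov,
    fun K' hK' => hK'.eq hcov (isInducedBySplitting_splittingInvolution hcov),
    splittingMetric cov, hP, fun G' _ hG' => ?_, fun α => ?_,
    hP.paraComplex.isInvolutive_eigenPlus, hP.paraComplex.isInvolutive_eigenMinus⟩
  · funext α
    refine ContinuousLinearMap.ext fun u => ContinuousLinearMap.ext fun v => ?_
    rw [splittingMetric_apply, hG', hsq]
  · refine ⟨eigenPlus_splittingInvolution hcov α, eigenMinus_splittingInvolution α, ?_, ?_, ?_, ?_,
      isCompl_of_involution (K := (splittingInvolution cov α).toLinearMap) (hsq α)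
        (fun _ => mem_eigenPlus) (fun _ => mem_eigenMinus)⟩
    · exact isMaximalIsotropic_fixed (K := (splittingInvolution cov α).toLinearMap)
        (b := bilinOfTwoForm (canonicalForm E M α)) (s := 1) (hsq α) (hanti α) (hnd α)
        (fun _ => mem_eigenPlus) (fun u v => by rw [one_mul, splittingMetric_apply]; rfl)
        one_ne_zero
    · exact isMaximalIsotropic_antifixed (K := (splittingInvolution cov α).toLinearMap)
        (b := bilinOfTwoForm (canonicalForm E M α)) (hsq α) (hanti α) (hnd α)
        (fun _ => mem_eigenMinus) (fun u v => splittingMetric_apply α u v)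
    · exact mem_fixed_iff (K := (splittingInvolution cov α).toLinearMap)
        (b := bilinOfTwoForm (canonicalForm E M α)) (hsq α) (hanti α) (hnd α)
        (fun _ => mem_eigenPlus)
    · exact mem_antifixed_iff (K := (splittingInvolution cov α).toLinearMap)
        (b := bilinOfTwoForm (canonicalForm E M α)) (hsq α) (hanti α) (hnd α)
        (fun _ => mem_eigenMinus)
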